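/- A matroid $M$ with rank function $\rho$ on a finite set $E$ has minimum distance $d(M)=\min\{|X| : X\subseteq E,\ \rho(E\setminus X)<\rho(E)\}$ (with $\min\emptyset=\infty$). For integers $0<r\le k$ and $\delta\ge 2$, $M$ is called an $(n,k,d,r,\delta)$-matroid if $|E|=n$, $\rho(E)=k$, $d(M)=d$, and every $x\in E$ lies in a set $S_x\subseteq E$ with $|S_x|\le r+\delta-1$ and $d(M|S_x)\ge\delta$. **Theorem.** Let $n,k,r,\delta$ be integers with $\delta\ge 2$ and $0<r<k\le n-\lceil k/r\rceil(\delta-1)$. Put $a=r\lceil k/r\rceil-k$ and $b=(r+\delta-1)\left\lceil\frac{n}{r+\delta-1}\right\rceil-n$. Then there is a largest $d$ for which an $(n,k,d,r,\delta)$-matroid exists; denote it by $d_{\max}=d_{\max}(n,k,r,\delta)$, and write $D=n-k+1-(\lceil k/r\rceil-1)(\delta-1)$ for the generalized Singleton bound. The following hold. (i) If $a\ge b$, then $d_{\max}=D$. (ii) If $b>a$ and $b\ge r$, then $d_{\max}\ge n-k+1-\lceil k/r\rceil(\delta-1)+(b-r)$. (iii) If $b>a$ and $a<\lceil k/r\rceil-1$,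 then $d_{\max}=D$ if and only if $\left\lfloor\lceil k/r\rceil/2\right\rfloor\le a$ and $$\left\lceil\frac{n}{r+\delta-1}\right\rceil\ge\left\lceil\frac kr\right\rceil-1+(b-a)\left(1+\frac1t\right),\qquad t=\left\lfloor\frac{a}{\lceil k/r\rceil-1-a}\right\rfloor$$ (the first condition is equivalent to $t\ge1$, so the second makes sense whenever the first holds). (iv) If $b>a\ge\lceil k/r\rceil-1$, $\lceil k/r\rceil\ge3$ and $$\left\lceil\frac{n}{r+\delta-1}\right\rceil\ge\left\lfloor\frac{b}{stu}\right\rfloor\bigl(t(u-1)+2\bigr)+y,$$ where $s=\left\lfloor\frac{a}{\lceil k/r\rceil-1}\right\rfloor$, $t=\left\lfloor\frac{r-1}{s}\right\rfloor$, $u=\left\lceil\frac{\lceil k/r\rceil+1}{2}\right\rceil$, $x=\left\lceil\frac{b-\lfloor b/(stu)\rfloor stu}{s}\right\rceil$, and $y=0$ if $stu\mid b$, while $y=x-\lfloor x/u\rfloor+1+\min\{\lfloor x/u\rfloor,1\}$ if $stu\nmid b$, then $d_{\max}=D$. (v) If $b>a\ge\lceil k/r\rceil-1$ and $\lceil k/r\rceil=2$,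 and either $2a\le r-1$ and $\left\lceil\frac{n}{r+\delta-1}\right\rceil\ge\left\lceil\frac ba\right\rceil+1$, or $2a>r-1$, $r\ge3$ and $\left\lceil\frac{n}{r+\delta-1}\right\rceil\ge\left\lceil\frac{b}{\lfloor (r-1)/2\rfloor}\right\rceil+1$, then $d_{\max}=D$. -/

import Mathlib

namespace LocalMatroid

/-- The minimum distance of a matroid: the least size of a set of elements whose removal
lowers the rank. It is `⊤` when no such set exists, that is, when the matroid has rank zero. -/
noncomputable def minDist {α : Type*} (M : Matroid α) : ℕ∞ :=
  ⨅ (X : Set α) (_ : X ⊆ M.E) (_ : M.eRk (M.E \ X) < M.eRank), X.encard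

/-- `S` is an `(r, δ)`-locality set of `M`: a subset of the ground set with at most `r + δ - 1`
elements such that the restriction of `M` to `S` has minimum distance at least `δ`. -/
structure IsLocalitySet {α : Type*} (M : Matroid α) (r δ : ℕ) (S : Set α) : Prop where
  subset_ground : S ⊆ M.E
  encard_le : S.encard ≤ ((r + δ - 1 : ℕ) : ℕ∞)
  le_minDist : (δ : ℕ∞) ≤ minDist (M.restrict S)

/-- `M` is an `(n, k, d, r, δ)`-matroid: a matroid on `n` elements, of rank `k`, of minimum
distance `d`, in which every element lies in an `(r, δ)`-locality set. -/
structure IsLRMatroid {α : Type*} (M : Matroid α) (n k d r δ : ℕ) : Prop where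
  encard_ground : M.E.encard = n
  eRank_eq : M.eRank = k
  minDist_eq : minDist M = d
  r_pos : 0 < r
  r_le : r ≤ k
  two_le_delta : 2 ≤ δ
  locality : ∀ x ∈ M.E, ∃ S : Set α, x ∈ S ∧ IsLocalitySet M r δ S

/-- The set of all `d` for which there exists an `(n, k, d, r, δ)`-matroid. -/
def distances (n k r δ : ℕ) : Set ℕ :=
  {d | ∃ (α : Type) (M : Matroid α), IsLRMatroid M n k d r δ}

/-- The largest `d` for which there exists an `(n, k, d, r, δ)`-matroid
(meaningful when `distances n k r δ` has a greatest element). -/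
noncomputable def dMax (n k r δ : ℕ) : ℕ := sSup (distances n k r δ)

/-- The right-hand side `n - k + 1 - (⌈k / r⌉ - 1) (δ - 1)` of the generalized Singleton bound. -/
def singletonBound (n k r δ : ℕ) : ℤ :=
  (n : ℤ) - k + 1 - (⌈(k : ℚ) / r⌉ - 1) * ((δ : ℤ) - 1)

end LocalMatroid

/-! Write `N = r + δ - 1`, `κ = ⌈k / r⌉`, `ν = ⌈n / N⌉`, and call `|I| * N - |⋃ S i|` the deficiency
of a subfamily `I` of a family of sets of size at most `N`. The theorem becomes a question about
families of small sets.

Upper bound: a nonspanning set has nullity at most `n - d - k + 1`, while `κ - 1` successively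
adjoined locality sets have rank at most `(κ - 1) r < k` and nullity at least `(κ - 1)(δ - 1)`; this
is the generalized Singleton bound (`IsLRMatroid.le_singletonBound`). If it is attained, a minimal
cover by locality sets has deficiency at most `a` on any `κ` members (`IsLRMatroid.exists_cover`).

Lower bound: conversely, prescribing nullity `δ - 1` for each set of a cover and truncating at rank
`k` gives a matroid (`exists_mem_distances`); it attains the bound if every `κ` or more members have
a large union (`exists_mem_distances_of_design`). What is needed is `ν` sets of total deficiency
`b`, any `κ` of which have deficiency at most `a`. Disjoint blocks give (i) and, with one block of
larger nullity, (ii).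

If `a < κ - 1`, a connected subfamily of `m` members has deficiency at least `m - 1`, so overlaps
must form small trees. Counting these (`deficiency_le`) gives the necessity in (iii), and stars with
`t + 1` members the sufficiency (`exists_mem_distances_of_forest`).

If `a ≥ κ - 1`, let the shared elements be the edges of a multigraph on `ν` vertices; deficiency
then counts spanned edges. Theta graphs of girth above `κ` with `s`-fold edges give (iv), `s`-fold
paths give (v). -/

namespace LocalMatroid

/-! ### Matroids from integer rank functions. -/

section RankFunction

variable {α : Type*} [DecidableEq α] {ρ : Finset α → ℤ}

lemma rank_union_le_add_card (hins : ∀ e X, ρ (insert e X) ≤ ρ X + 1) (X Y : Finset α) :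
    ρ (X ∪ Y) ≤ ρ X + Y.card := by
  induction Y using Finset.induction_on with
  | empty => simp
  | insert e Y he ih =>
    rw [Finset.union_insert, Finset.card_insert_of_notMem he]
    push_cast
    linarith [hins e (X ∪ Y)]

/-- Submodularity for `insert e X` and `X ∪ Y`, which meet at least in `X`, absorbs the elements of
`Y` one after the other. -/
lemma rank_union_eq_of_forall_insert (hmono : Monotone ρ)
    (hsub : ∀ X Y, ρ (X ∪ Y) + ρ (X ∩ Y) ≤ ρ X + ρ Y) {X Y : Finset α}
    (h : ∀ e ∈ Y, ρ (insert e X) = ρ X) : ρ (X ∪ Y) = ρ X := by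
  induction Y using Finset.induction_on with
  | empty => simp
  | insert e Y he ih =>
    have ih' := ih fun f hf ↦ h f (Finset.mem_insert_of_mem hf)
    have h1 := hsub (insert e X) (X ∪ Y)
    have h2 : insert e X ∪ (X ∪ Y) = X ∪ insert e Y := by
      ext; simp only [Finset.mem_union, Finset.mem_insert]; tauto
    have h3 : X ⊆ insert e X ∩ (X ∪ Y) :=
      Finset.subset_inter (Finset.subset_insert _ _) Finset.subset_union_left
    have h4 := hmono h3
    have h5 : ρ X ≤ ρ (X ∪ insert e Y) := hmono Finset.subset_union_left
    rw [h2, h e (Finset.mem_insert_self _ _)] at h1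
    linarith

/-- A normalized, monotone, submodular function with unit increments on the subsets of a finite
type is the rank function of a matroid. -/
theorem exists_matroid_eRk_eq [Fintype α] (h0 : ρ ∅ = 0)
    (hins : ∀ e X, ρ (insert e X) ≤ ρ X + 1) (hmono : Monotone ρ)
    (hsub : ∀ X Y, ρ (X ∪ Y) + ρ (X ∩ Y) ≤ ρ X + ρ Y) :
    ∃ M : Matroid α, M.E = Set.univ ∧ ∀ X : Finset α, M.eRk X = ((ρ X).toNat : ℕ∞) := by
  have hstep : ∀ I : Finset α, ρ I = I.card → ∀ e, e ∉ I → ρ (insert e I) ≠ (insert e I).card →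
      ρ (insert e I) = ρ I := by
    intro I hI e he hne
    rw [Finset.card_insert_of_notMem he] at hne
    have h1 := hins e I
    have h2 : ρ I ≤ ρ (insert e I) := hmono (Finset.subset_insert _ _)
    push_cast at hne
    omega
  let P := IndepMatroid.ofFinset (Set.univ : Set α) (fun I ↦ ρ I = I.card) (by simpa using h0)
    (by
      intro I J hJ hIJ
      have h1 := rank_union_le_add_card hins I (J \ I)
      have h2 := rank_union_le_add_card hins ∅ I
      rw [Finset.union_sdiff_of_subset hIJ, hJ] at h1
      have h3 := Finset.card_sdiff_add_card_eq_card hIJ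
      rw [Finset.empty_union] at h2
      show ρ I = I.card
      omega)
    (by
      intro I J hI hJ hIJ
      by_contra! hcon
      have h1 : ρ (I ∪ J) = ρ I := by
        refine rank_union_eq_of_forall_insert hmono hsub fun e heJ ↦ ?_
        by_cases he : e ∈ I
        · rw [Finset.insert_eq_of_mem he]
        · exact hstep I hI e he (hcon e heJ he)
      have h2 : ρ J ≤ ρ (I ∪ J) := hmono Finset.subset_union_right
      omega)
    (fun _ _ ↦ Set.subset_univ _)
  refine ⟨P.matroid, rfl, fun X ↦ ?_⟩
  have hind : ∀ I : Finset α, P.matroid.Indep I ↔ ρ I = I.card := by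
    intro I
    change P.Indep I ↔ _
    simp only [P, IndepMatroid.ofFinset_indep]
  obtain ⟨I, hI⟩ := P.matroid.exists_isBasis (X : Set α) (Set.subset_univ _)
  obtain ⟨I, rfl⟩ : ∃ I' : Finset α, (I' : Set α) = I :=
    ⟨(Set.toFinite I).toFinset, by simp⟩
  have hIX : I ⊆ X := by exact_mod_cast hI.subset
  have hI' := (hind I).1 hI.indep
  have h1 : ρ (I ∪ X) = ρ I := by
    refine rank_union_eq_of_forall_insert hmono hsub fun e heX ↦ ?_
    by_cases he : e ∈ I
    · rw [Finset.insert_eq_of_mem he]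
    · refine hstep I hI' e he fun h ↦ he ?_
      have := (hind (insert e I)).2 h
      have h' := hI.mem_of_insert_indep (e := e) (by exact_mod_cast heX) (by simpa using this)
      exact_mod_cast h'
  rw [Finset.union_eq_right.2 hIX] at h1
  rw [hI.eRk_eq_encard, h1, hI', Set.encard_coe_eq_coe_finsetCard]
  simp

end RankFunction

/-! ### Rank functions with prescribed nullities. -/

section CoverRank

variable {α ι : Type*} [DecidableEq α] [Fintype ι]

/-- The rank function, before truncation, of the freest matroid in which every union of the sets
`S i`, `i ∈ I`, has nullity at least `∑ i ∈ I, w i`. -/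
def coverRank (S : ι → Finset α) (w : ι → ℕ) (X : Finset α) : ℤ :=
  Finset.univ.inf' ⟨∅, Finset.mem_univ _⟩
    fun I : Finset ι ↦ ((X ∪ I.biUnion S).card : ℤ) - ∑ i ∈ I, (w i : ℤ)

variable {S : ι → Finset α} {w : ι → ℕ}

lemma coverRank_le (X : Finset α) (I : Finset ι) :
    coverRank S w X ≤ ((X ∪ I.biUnion S).card : ℤ) - ∑ i ∈ I, (w i : ℤ) :=
  Finset.inf'_le _ (Finset.mem_univ I)

lemma exists_coverRank_eq (S : ι → Finset α) (w : ι → ℕ) (X : Finset α) :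
    ∃ I : Finset ι, coverRank S w X = ((X ∪ I.biUnion S).card : ℤ) - ∑ i ∈ I, (w i : ℤ) := by
  obtain ⟨I, -, hI⟩ := Finset.exists_mem_eq_inf' (s := (Finset.univ : Finset (Finset ι)))
    ⟨∅, Finset.mem_univ _⟩
    fun I : Finset ι ↦ ((X ∪ I.biUnion S).card : ℤ) - ∑ i ∈ I, (w i : ℤ)
  exact ⟨I, hI⟩

lemma coverRank_mono : Monotone (coverRank S w) := by
  intro X Y hXY
  obtain ⟨I, hI⟩ := exists_coverRank_eq S w Y
  refine (coverRank_le X I).trans ?_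
  have := Finset.card_le_card (Finset.union_subset_union_left hXY : X ∪ I.biUnion S ⊆ _)
  rw [hI]
  omega

lemma coverRank_insert_le (e : α) (X : Finset α) :
    coverRank S w (insert e X) ≤ coverRank S w X + 1 := by
  obtain ⟨I, hI⟩ := exists_coverRank_eq S w X
  refine (coverRank_le (insert e X) I).trans ?_
  have := Finset.card_insert_le e (X ∪ I.biUnion S)
  rw [hI, Finset.insert_union]
  omega

/-- If `I` and `J` are optimal for `X` and `Y`, then `I ∪ J` and `I ∩ J` are admissible for the
union and the intersection. The weights are modular, and the union over `I ∩ J` lies in both unions.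
-/
lemma coverRank_submodular [DecidableEq ι] (X Y : Finset α) :
    coverRank S w (X ∪ Y) + coverRank S w (X ∩ Y) ≤ coverRank S w X + coverRank S w Y := by
  obtain ⟨I, hI⟩ := exists_coverRank_eq S w X
  obtain ⟨J, hJ⟩ := exists_coverRank_eq S w Y
  have h1 := coverRank_le (S := S) (w := w) (X ∪ Y) (I ∪ J)
  have h2 := coverRank_le (S := S) (w := w) (X ∩ Y) (I ∩ J)
  have h3 := Finset.sum_union_inter (s₁ := I) (s₂ := J) (f := fun i ↦ (w i : ℤ))
  have h4 := Finset.card_union_add_card_inter (X ∪ I.biUnion S) (Y ∪ J.biUnion S)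
  have h5 : X ∪ Y ∪ (I ∪ J).biUnion S = X ∪ I.biUnion S ∪ (Y ∪ J.biUnion S) := by
    ext x; simp only [Finset.mem_union, Finset.mem_biUnion]; grind
  have h6 : X ∩ Y ∪ (I ∩ J).biUnion S ⊆ (X ∪ I.biUnion S) ∩ (Y ∪ J.biUnion S) := by
    intro x; simp only [Finset.mem_union, Finset.mem_biUnion, Finset.mem_inter]; grind
  have h7 := Finset.card_le_card h6
  rw [h5] at h1
  omega

lemma coverRank_empty (h : ∀ I : Finset ι, ∑ i ∈ I, w i ≤ (I.biUnion S).card) :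
    coverRank S w ∅ = 0 := by
  refine le_antisymm ((coverRank_le ∅ ∅).trans (by simp)) ?_
  obtain ⟨I, hI⟩ := exists_coverRank_eq S w ∅
  have := h I
  rw [hI, Finset.empty_union]
  zify at this
  linarith

/-- Removing few elements of a subset of `S i` does not lower the rank. -/
lemma coverRank_eq_of_subset [DecidableEq ι] {X Y : Finset α} {i : ι} (hYX : Y ⊆ X) (hXS : X ⊆ S i)
    (h : (S i \ Y).card ≤ w i) : coverRank S w Y = coverRank S w X := by
  refine le_antisymm (coverRank_mono hYX) ?_
  obtain ⟨I, hI⟩ := exists_coverRank_eq S w Y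
  rw [hI]
  by_cases hi : i ∈ I
  · refine (coverRank_le X I).trans ?_
    have h1 : X ∪ I.biUnion S ⊆ Y ∪ I.biUnion S := by
      refine Finset.union_subset (fun x hx ↦ ?_) Finset.subset_union_right
      exact Finset.mem_union_right _ (Finset.mem_biUnion.2 ⟨i, hi, hXS hx⟩)
    have := Finset.card_le_card h1
    omega
  · refine (coverRank_le X (insert i I)).trans ?_
    have h1 : X ∪ (insert i I).biUnion S ⊆ (Y ∪ I.biUnion S) ∪ (S i \ Y) := by
      intro x hx
      have := @hXS x
      simp only [Finset.mem_union, Finset.biUnion_insert, Finset.mem_sdiff] at hx ⊢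
      tauto
    have h2 := (Finset.card_le_card h1).trans (Finset.card_union_le _ _)
    rw [Finset.sum_insert hi]
    omega

end CoverRank

/-! ### From set families to locally repairable matroids. -/

lemma exists_subset_card_eq_mem {α : Type*} [DecidableEq α] {s : Finset α} {x : α} (hx : x ∈ s)
    {m : ℕ} (hm : 0 < m) (hms : m ≤ s.card) : ∃ t ⊆ s, x ∈ t ∧ t.card = m := by
  obtain ⟨t, h1, h2, h3⟩ := Finset.exists_subsuperset_card_eq
    (Finset.singleton_subset_iff.2 hx) (by rw [Finset.card_singleton]; exact hm) hms
  exact ⟨t, h2, Finset.singleton_subset_iff.1 h1, h3⟩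

/-- A covering family of sets with prescribed nullities yields a locally repairable matroid. -/
theorem exists_mem_distances {α ι : Type} [Fintype α] [DecidableEq α] [Fintype ι] [DecidableEq ι]
    (S : ι → Finset α) (w : ι → ℕ) {k r δ : ℕ} {D : ℤ} (hδ : 2 ≤ δ) (hr : 0 < r) (hrk : r ≤ k)
    (hcover : ∀ x, ∃ i, x ∈ S i) (hw : ∀ i, δ ≤ w i + 1) (hS : ∀ i, (S i).card ≤ w i + r)
    (hsmall : ∀ I : Finset ι, ∑ i ∈ I, w i ≤ (I.biUnion S).card)
    (hbig : k + ∑ i, w i ≤ Fintype.card α)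
    (hD : ∀ I : Finset ι, (I.biUnion S).card < k + ∑ i ∈ I, w i →
      D + k - 1 + ∑ i ∈ I, (w i : ℤ) ≤ Fintype.card α) :
    ∃ d : ℕ, D ≤ d ∧ d ∈ distances (Fintype.card α) k r δ := by
  set ρ : Finset α → ℤ := fun X ↦ min (k : ℤ) (coverRank S w X) with hρ
  have hmono : Monotone ρ := fun X Y h ↦ min_le_min le_rfl (coverRank_mono h)
  obtain ⟨M, hME, hM⟩ := exists_matroid_eRk_eq (ρ := ρ)
    (by simp only [hρ]; rw [coverRank_empty hsmall]; omega)
    (fun e X ↦ by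
      have := coverRank_insert_le (S := S) (w := w) e X
      simp only [hρ]; omega)
    hmono
    (fun X Y ↦ by
      have h1 := coverRank_submodular (S := S) (w := w) X Y
      have h2 := coverRank_mono (S := S) (w := w) (Finset.subset_union_left : X ⊆ X ∪ Y)
      have h3 := coverRank_mono (S := S) (w := w) (Finset.subset_union_right : Y ⊆ X ∪ Y)
      have h4 := coverRank_mono (S := S) (w := w) (Finset.inter_subset_left : X ∩ Y ⊆ X)
      have h5 := coverRank_mono (S := S) (w := w) (Finset.inter_subset_right : X ∩ Y ⊆ Y)
      simp only [hρ]; omega)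
  have hnonneg : ∀ X, 0 ≤ ρ X := fun X ↦ by
    have := coverRank_mono (S := S) (w := w) (Finset.empty_subset X)
    rw [coverRank_empty hsmall] at this
    simp only [hρ]; omega
  have hlt : ∀ X Y : Finset α, M.eRk X < M.eRk Y ↔ ρ X < ρ Y := fun X Y ↦ by
    rw [hM, hM, Nat.cast_lt]
    have := hnonneg X
    omega
  have htop : ρ Finset.univ = k := by
    obtain ⟨I, hI⟩ := exists_coverRank_eq S w Finset.univ
    have h1 : ∑ i ∈ I, w i ≤ ∑ i, w i :=
      Finset.sum_le_sum_of_subset (Finset.subset_univ I)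
    rw [Finset.union_eq_left.2 (Finset.subset_univ _), Finset.card_univ] at hI
    simp only [hρ, hI]
    zify at h1 hbig
    omega
  have hrank : M.eRank = k := by
    rw [M.eRank_def, hME, ← Finset.coe_univ, hM, htop]
    simp
  -- If the complement of `X` has rank below `k`, an optimal `I` for it satisfies the premise of
  -- `hD`, and the complement has at most `k - 1 + ∑ i ∈ I, w i` elements.
  have hdist : ∀ X : Set α, M.eRk (M.E \ X) < M.eRank → D ≤ X.ncard := by
    intro X hX
    obtain ⟨X, rfl⟩ : ∃ X' : Finset α, (X' : Set α) = X :=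
      ⟨(Set.toFinite X).toFinset, by simp⟩
    rw [M.eRank_def, hME, ← Finset.coe_univ, ← Finset.coe_sdiff, hlt, htop] at hX
    obtain ⟨I, hI⟩ := exists_coverRank_eq S w (Finset.univ \ X)
    simp only [hρ] at hX
    have h1 := Finset.card_le_card
      (Finset.subset_union_right : I.biUnion S ⊆ (Finset.univ \ X) ∪ I.biUnion S)
    have h2 := Finset.card_le_card
      (Finset.subset_union_left : Finset.univ \ X ⊆ (Finset.univ \ X) ∪ I.biUnion S)
    have h3 := Finset.card_sdiff_add_card_eq_card (Finset.subset_univ X)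
    have h4 := hD I (by zify; omega)
    rw [Finset.card_univ] at h3
    rw [Set.ncard_coe_finset]
    omega
  have hfin : minDist M ≠ ⊤ := by
    refine ne_top_of_le_ne_top (b := M.E.encard) ?_ ?_
    · exact Set.encard_ne_top_iff.2 (Set.toFinite _)
    · refine iInf₂_le_of_le M.E subset_rfl (iInf_le_of_le ?_ le_rfl)
      rw [Set.sdiff_self, M.eRk_empty, hrank]
      exact_mod_cast hr.trans_le hrk
  obtain ⟨d, hd⟩ := ENat.ne_top_iff_exists.1 hfin
  refine ⟨d, ?_, α, M, ?_⟩
  · have h1 : ((D.toNat : ℕ) : ℕ∞) ≤ minDist M := by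
      refine le_iInf fun X ↦ le_iInf fun _ ↦ le_iInf fun hX ↦ ?_
      have := hdist X hX
      rw [← (Set.toFinite X).cast_ncard_eq, Nat.cast_le]
      omega
    rw [← hd, Nat.cast_le] at h1
    omega
  refine ⟨?_, hrank, hd.symm, hr, hrk, hδ, fun x _ ↦ ?_⟩
  · rw [hME, Set.encard_univ, ENat.card_eq_coe_fintype_card]
  obtain ⟨i, hi⟩ := hcover x
  have hpos : 0 < (S i).card := Finset.card_pos.2 ⟨x, hi⟩
  -- `S i` may exceed `r + δ - 1`. Trimming `w i + 1 - δ` elements repairs this, and losing `δ - 1`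
  -- more stays within the tolerance `w i` of `coverRank_eq_of_subset`. The maximum with `1` leaves
  -- room for `x`.
  obtain ⟨T, hTS, hxT, hT⟩ := exists_subset_card_eq_mem hi
    (m := max 1 ((S i).card - (w i + 1 - δ))) (by omega) (by omega)
  refine ⟨T, hxT, hME ▸ Set.subset_univ _, ?_, ?_⟩
  · rw [Set.encard_coe_eq_coe_finsetCard, hT, Nat.cast_le]
    have := hS i
    have := hw i
    omega
  · refine le_iInf fun X ↦ le_iInf fun hX ↦ le_iInf fun hlow ↦ ?_
    obtain ⟨X, rfl⟩ : ∃ X' : Finset α, (X' : Set α) = X :=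
      ⟨(Set.toFinite X).toFinset, by simp⟩
    rw [Matroid.restrict_ground_eq] at hX hlow
    rw [Matroid.restrict_eRk_eq _ Set.sdiff_subset, Matroid.eRank_restrict, ← Finset.coe_sdiff,
      hlt] at hlow
    have hXT : X ⊆ T := by exact_mod_cast hX
    rw [Set.encard_coe_eq_coe_finsetCard, Nat.cast_le]
    by_contra! hcard
    refine hlow.ne ?_
    simp only [hρ]
    rw [coverRank_eq_of_subset (Finset.sdiff_subset : T \ X ⊆ T) hTS]
    have h1 : S i \ (T \ X) ⊆ (S i \ T) ∪ X := by
      intro y; simp only [Finset.mem_sdiff, Finset.mem_union]; tauto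
    have h2 := (Finset.card_le_card h1).trans (Finset.card_union_le _ _)
    have h3 := Finset.card_sdiff_add_card_eq_card hTS
    have := hw i
    omega

/-- A covering family of small sets whose unions of at least `κ` members are large yields a locally
repairable matroid attaining the generalized Singleton bound. -/
theorem exists_mem_distances_of_design {α ι : Type} [Fintype α] [DecidableEq α] [Fintype ι]
    [DecidableEq ι] (S : ι → Finset α) {k r δ κ a : ℕ} (hδ : 2 ≤ δ) (hrk : r < k)
    (hκ : κ ≤ Fintype.card ι) (ha : k + a = κ * r) (har : a < r)
    (hcover : ∀ x, ∃ i, x ∈ S i) (hS : ∀ i, (S i).card ≤ r + δ - 1)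
    (hI : ∀ I : Finset ι, κ ≤ I.card → k + I.card * (δ - 1) ≤ (I.biUnion S).card) :
    ∃ d : ℕ, (Fintype.card α : ℤ) - k + 1 - (κ - 1) * (δ - 1) ≤ d ∧
      d ∈ distances (Fintype.card α) k r δ := by
  obtain ⟨ε, rfl⟩ : ∃ ε, δ = ε + 1 := ⟨δ - 1, by omega⟩
  simp only [Nat.add_sub_cancel] at hI
  have hsmall : ∀ I : Finset ι, I.card * ε ≤ (I.biUnion S).card := by
    intro I
    rcases le_or_gt κ I.card with h | h
    · exact le_of_add_le_right (hI I h)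
    rcases I.eq_empty_or_nonempty with rfl | hne
    · simp
    -- Enlarge `I` to `κ` members: each new set covers at most `r + ε` elements, so `I` covers at
    -- least `I.card * (r + ε) - a`, and `a < r`.
    obtain ⟨J, hIJ, -, hJ⟩ := Finset.exists_subsuperset_card_eq (Finset.subset_univ I) h.le
      (by rwa [Finset.card_univ])
    have h1 := hI J hJ.ge
    have h2 : (J.biUnion S).card ≤ (I.biUnion S).card + ((J \ I).biUnion S).card := by
      rw [← Finset.union_sdiff_of_subset hIJ, Finset.union_biUnion,
        Finset.union_sdiff_of_subset hIJ]
      exact Finset.card_union_le _ _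
    have h3 : ((J \ I).biUnion S).card ≤ (J \ I).card * (r + ε) :=
      Finset.card_biUnion_le_card_mul _ _ _ fun i _ ↦ by have := hS i; omega
    have h4 := Finset.card_sdiff_add_card_eq_card hIJ
    have h5 := hne.card_pos
    rw [hJ] at h1 h4
    generalize (J \ I).card = p at *
    generalize I.card = q at *
    subst h4
    nlinarith
  refine exists_mem_distances S (fun _ ↦ ε) hδ (by omega) hrk.le hcover (fun _ ↦ le_rfl)
    (fun i ↦ by have := hS i; omega) (fun I ↦ by simpa using hsmall I) ?_ fun I h ↦ ?_
  · have := hI Finset.univ (by rwa [Finset.card_univ])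
    simp only [Finset.sum_const, smul_eq_mul]
    exact this.trans (Finset.card_le_univ _)
  · simp only [Finset.sum_const, smul_eq_mul, nsmul_eq_mul] at h ⊢
    have h1 : I.card < κ := by
      by_contra! hc
      exact absurd (hI I hc) (by omega)
    have h2 : (I.card : ℤ) ≤ κ - 1 := by omega
    have h3 : (I.card : ℤ) * ε ≤ (κ - 1) * ε := by gcongr
    push_cast
    linarith

/-! ### Constructions with disjoint blocks. -/

section DisjointBlocks

variable {ι : Type} (c : ι → ℕ)

/-- The `i`-th block of a disjoint union of blocks of sizes `c i`. -/
def block (i : ι) : Finset (Σ i, Fin (c i)) := Finset.univ.map (Function.Embedding.sigmaMk i)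

lemma card_block (i : ι) : (block c i).card = c i := by simp [block]

lemma mem_block (x : Σ i, Fin (c i)) : x ∈ block c x.1 := by
  simp only [block, Finset.mem_map, Finset.mem_univ, true_and, Function.Embedding.sigmaMk_apply]
  exact ⟨x.2, rfl⟩

lemma card_biUnion_block [DecidableEq ι] (I : Finset ι) : (I.biUnion (block c)).card = ∑ i ∈ I, c i := by
  rw [Finset.card_biUnion]
  · simp [card_block]
  · intro i _ j _ hij
    rw [Function.onFun, Finset.disjoint_left]
    intro x hx hy
    simp only [block, Finset.mem_map, Function.Embedding.sigmaMk_apply] at hx hy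
    obtain ⟨_, _, rfl⟩ := hx
    obtain ⟨_, _, h⟩ := hy
    exact hij (congrArg Sigma.fst h).symm

lemma card_sigma_fin [Fintype ι] : Fintype.card (Σ i, Fin (c i)) = ∑ i, c i := by simp

end DisjointBlocks

lemma sum_ite_zero_add {m : ℕ} (I : Finset (Fin (m + 1))) (b : ℕ) :
    ∑ i ∈ I, (if i = 0 then b else 0) ≤ b := by
  rw [Finset.sum_ite_eq']
  split_ifs <;> simp

lemma card_mul_le_sum_add {m N b : ℕ} (hb : b ≤ N) (I : Finset (Fin (m + 1))) :
    I.card * N ≤ ∑ i ∈ I, (N - if i = 0 then b else 0) + b := by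
  have h1 : ∑ i ∈ I, (N - if i = 0 then b else 0) + ∑ i ∈ I, (if i = 0 then b else 0) =
      I.card * N := by
    rw [← Finset.sum_add_distrib, ← smul_eq_mul, ← Finset.sum_const]
    refine Finset.sum_congr rfl fun i _ ↦ ?_
    split_ifs <;> omega
  have := sum_ite_zero_add I b
  omega

lemma sum_sub_ite_add {m N b : ℕ} (hb : b ≤ N) :
    ∑ i : Fin (m + 1), (N - if i = 0 then b else 0) + b = (m + 1) * N := by
  rw [Fin.sum_univ_succ]
  simp only [Fin.succ_ne_zero, if_true, if_false, Finset.sum_const, Finset.card_univ,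
    Fintype.card_fin, smul_eq_mul, Nat.sub_zero]
  rw [add_one_mul]
  omega

/-- If `b ≤ a`, disjoint blocks attain the generalized Singleton bound. -/
theorem exists_mem_distances_of_le {n k r δ κ ν a b : ℕ} (hδ : 2 ≤ δ) (hrk : r < k)
    (ha : k + a = κ * r) (har : a < r) (hb : n + b = ν * (r + δ - 1)) (hκν : κ ≤ ν)
    (hba : b ≤ a) :
    ∃ d : ℕ, (n : ℤ) - k + 1 - (κ - 1) * (δ - 1) ≤ d ∧ d ∈ distances n k r δ := by
  obtain ⟨m, rfl⟩ : ∃ m, ν = m + 1 := ⟨ν - 1, by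
    have : κ ≠ 0 := by rintro rfl; omega
    omega⟩
  have hbN : b ≤ r + δ - 1 := by omega
  let c : Fin (m + 1) → ℕ := fun i ↦ r + δ - 1 - if i = 0 then b else 0
  have hn : Fintype.card (Σ i, Fin (c i)) = n := by
    rw [card_sigma_fin]
    have := sum_sub_ite_add (m := m) hbN
    simp only [c]
    omega
  rw [← hn]
  refine exists_mem_distances_of_design (block c) hδ hrk (by simpa using hκν) ha har
    (fun x ↦ ⟨x.1, mem_block c x⟩) (fun i ↦ ?_) fun I hI ↦ ?_
  · rw [card_block]
    simp only [c]
    omega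
  · rw [card_biUnion_block]
    have h1 := card_mul_le_sum_add hbN I
    have h2 : I.card * (r + δ - 1) = I.card * r + I.card * (δ - 1) := by
      rw [← mul_add]; congr 1; omega
    have h3 : κ * r ≤ I.card * r := Nat.mul_le_mul_right r hI
    simp only [c]
    omega

/-- Disjoint blocks, one of them large, give a lower bound. -/
theorem exists_mem_distances_of_lt {n k r δ κ ν a b : ℕ} (hδ : 2 ≤ δ) (hr : 0 < r) (hrk : r < k)
    (ha : k + a = κ * r) (hb : n + b = ν * (r + δ - 1)) (hκν : κ < ν)
    (hbN : b < r + δ - 1) :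
    ∃ d : ℕ, (n : ℤ) - k + 1 - κ * (δ - 1) + (b - r) ≤ d ∧ d ∈ distances n k r δ := by
  obtain ⟨m, rfl⟩ : ∃ m, ν = m + 2 := ⟨ν - 2, by
    have : κ ≠ 0 := by rintro rfl; omega
    omega⟩
  obtain ⟨ε, rfl⟩ : ∃ ε, δ = ε + 1 := ⟨δ - 1, by omega⟩
  obtain ⟨e, he⟩ : ∃ e, r + ε = b + e := ⟨r + ε - b, by omega⟩
  -- The `e = r + ε - b` elements left over by `ν - 1` full blocks join block `0` and count entirely
  -- as nullity, so every block contributes exactly `r` to size minus weight.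
  let w : Fin (m + 1) → ℕ := fun i ↦ ε + if i = 0 then e else 0
  let c : Fin (m + 1) → ℕ := fun i ↦ r + w i
  have hc : ∀ I : Finset (Fin (m + 1)), ∑ i ∈ I, c i = I.card * r + ∑ i ∈ I, w i := fun I ↦ by
    simp only [c]
    rw [Finset.sum_add_distrib, Finset.sum_const, smul_eq_mul]
  have hn' : ∑ i, c i = n := by
    rw [hc]
    simp only [w, Finset.sum_add_distrib, Finset.sum_const, Finset.card_univ, Fintype.card_fin,
      Finset.sum_ite_eq', Finset.mem_univ, if_true, smul_eq_mul]
    have : (m + 2) * (r + (ε + 1) - 1) = (m + 1) * r + (m + 1) * ε + (r + ε) := by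
      rw [← add_assoc, Nat.add_sub_cancel]; ring
    omega
  have hn : Fintype.card (Σ i, Fin (c i)) = n := by rw [card_sigma_fin, hn']
  obtain ⟨d, hd, hd'⟩ := exists_mem_distances
    (D := (n : ℤ) - k + 1 - κ * ((ε + 1 : ℕ) - 1) + (b - r)) (block c) w hδ hr
    hrk.le (fun x ↦ ⟨x.1, mem_block c x⟩) (fun _ ↦ by simp only [w]; omega)
    (fun i ↦ by rw [card_block]; simp only [c]; omega)
    (fun I ↦ by rw [card_biUnion_block, hc]; omega)
    (by
      rw [hn, ← hn', hc]
      have : κ * r ≤ (m + 1) * r := Nat.mul_le_mul_right r (by omega)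
      rw [Finset.card_univ, Fintype.card_fin]
      omega)
    (fun I hI ↦ by
      rw [card_biUnion_block, hc] at hI
      have h1 : I.card < κ := by
        by_contra! hcon
        have : κ * r ≤ I.card * r := Nat.mul_le_mul_right r hcon
        omega
      rw [hn]
      have h2 : ∑ i ∈ I, w i ≤ I.card * ε + e := by
        simp only [w]
        rw [Finset.sum_add_distrib, Finset.sum_const, smul_eq_mul]
        have := sum_ite_zero_add I e
        omega
      have h3 : (I.card + 1) * ε ≤ κ * ε := Nat.mul_le_mul_right ε h1
      zify at h2 h3 he
      push_cast
      linarith)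
  exact ⟨d, hd, hn ▸ hd'⟩

/-! ### The generalized Singleton bound and its equality case. -/

section UpperBound

variable {α : Type*} {M : Matroid α} {X Y S T : Set α} {n k d r δ : ℕ}

/-- The natural-number rank of a set. -/
noncomputable def rk (M : Matroid α) (X : Set α) : ℕ := (M.eRk X).toNat

/-- The nullity of a set. -/
noncomputable def nullity (M : Matroid α) (X : Set α) : ℤ := (X.ncard : ℤ) - rk M X

lemma coe_rk [M.Finite] (X : Set α) : (rk M X : ℕ∞) = M.eRk X := by
  refine ENat.natCast_toNat ?_
  rw [Matroid.eRk_ne_top_iff]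
  exact M.isRkFinite_set X

lemma rk_mono [M.Finite] (h : X ⊆ Y) : rk M X ≤ rk M Y := by
  rw [← Nat.cast_le (α := ℕ∞), coe_rk, coe_rk]
  exact M.eRk_mono h

lemma rk_union_le [M.Finite] (X Y : Set α) : rk M (X ∪ Y) ≤ rk M X + rk M Y := by
  rw [← Nat.cast_le (α := ℕ∞), Nat.cast_add, coe_rk, coe_rk, coe_rk]
  exact M.eRk_union_le_eRk_add_eRk X Y

lemma rk_closure [M.Finite] (X : Set α) : rk M (M.closure X) = rk M X := by
  simp [rk]

lemma rk_empty (M : Matroid α) : rk M ∅ = 0 := by simp [rk]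

lemma rk_le_ncard [M.Finite] (hX : X ⊆ M.E) : rk M X ≤ X.ncard := by
  rw [← Nat.cast_le (α := ℕ∞), coe_rk, (M.ground_finite.subset hX).cast_ncard_eq]
  exact M.eRk_le_encard X

lemma nullity_mono [M.Finite] (h : X ⊆ Y) (hY : Y ⊆ M.E) : nullity M X ≤ nullity M Y := by
  have h1 : rk M Y ≤ rk M X + rk M (Y \ X) := by
    rw [← Set.union_sdiff_cancel h]
    refine (rk_union_le _ _).trans ?_
    rw [Set.union_sdiff_cancel h]
  have h2 := rk_le_ncard (M := M) (Set.sdiff_subset.trans hY : Y \ X ⊆ M.E)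
  have h3 := Set.ncard_sdiff_add_ncard_of_subset h (M.ground_finite.subset hY)
  unfold nullity
  omega

lemma nullity_nonneg [M.Finite] (hX : X ⊆ M.E) : 0 ≤ nullity M X := by
  have := rk_le_ncard hX
  unfold nullity
  omega

namespace IsLocalitySet

lemma le_ncard_of_rk_lt [M.Finite] (hS : IsLocalitySet M r δ S) (hT : T ⊆ S)
    (h : rk M (S \ T) < rk M S) : δ ≤ T.ncard := by
  rw [← Nat.cast_lt (α := ℕ∞), coe_rk, coe_rk] at h
  rw [← Nat.cast_le (α := ℕ∞), ((M.ground_finite.subset hS.subset_ground).subset hT).cast_ncard_eq]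
  refine hS.le_minDist.trans (iInf₂_le_of_le T hT (iInf_le _ ?_))
  rw [Matroid.restrict_ground_eq, Matroid.restrict_eRk_eq _ Set.sdiff_subset,
    Matroid.eRank_restrict]
  exact h

lemma subset_closure [M.Finite] (hS : IsLocalitySet M r δ S) (hT : T ⊆ S)
    (h : ¬ rk M T < rk M S) : S ⊆ M.closure T := by
  have h1 : M.closure T = M.closure S := by
    refine (M.isRkFinite_set T).closure_eq_closure_of_subset_of_eRk_ge_eRk hT ?_
    rw [← coe_rk, ← coe_rk, Nat.cast_le]
    omega
  rw [h1]
  exact M.subset_closure S hS.subset_ground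

lemma rk_sdiff [M.Finite] (hS : IsLocalitySet M r δ S) (hT : T ⊆ S) (h : T.ncard < δ) :
    rk M (S \ T) = rk M S :=
  le_antisymm (rk_mono Set.sdiff_subset)
    (not_lt.1 fun hlt ↦ absurd (hS.le_ncard_of_rk_lt hT hlt) (not_le.2 h))

lemma ncard_le [M.Finite] (hS : IsLocalitySet M r δ S) : S.ncard ≤ r + δ - 1 := by
  have := hS.encard_le
  rwa [← (M.ground_finite.subset hS.subset_ground).cast_ncard_eq, Nat.cast_le] at this

/-- For `δ > 0`, positive rank forces at least `δ` elements; dropping `δ - 1` of them keeps the rank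
and leaves at most `r` elements. -/
lemma rk_le [M.Finite] (hS : IsLocalitySet M r δ S) : rk M S ≤ r := by
  by_contra! h
  have hfin := M.ground_finite.subset hS.subset_ground
  have h1 : δ ≤ S.ncard := hS.le_ncard_of_rk_lt subset_rfl (by
    rw [Set.sdiff_self, rk_empty]; omega)
  obtain ⟨T, hTS, hT⟩ := Set.exists_subset_card_eq (s := S) (n := δ - 1) (by omega)
  have h2 := hS.ncard_le
  have h3 := Set.ncard_sdiff_add_ncard_of_subset hTS hfin
  have h4 := rk_le_ncard (M := M) (Set.sdiff_subset.trans hS.subset_ground : S \ T ⊆ M.E)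
  by_cases hδ : δ = 0
  · have := rk_le_ncard hS.subset_ground
    omega
  rw [hS.rk_sdiff hTS (by omega)] at h4
  omega

/-- Adjoining a locality set that is not contained in the closure adds nullity `δ - 1`. -/
lemma nullity_closure_union [M.Finite] (hS : IsLocalitySet M r δ S) (hX : X ⊆ M.E) (hδ : 0 < δ)
    (h : ¬ S ⊆ M.closure X) : nullity M X + (δ - 1) ≤ nullity M (M.closure X ∪ S) := by
  have hfin := M.ground_finite.subset hS.subset_ground
  have hcfin := M.ground_finite.subset (M.closure_subset_ground X)
  -- Otherwise `S ∩ M.closure X` would still span `S`.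
  have h1 : δ ≤ (S \ M.closure X).ncard := by
    refine hS.le_ncard_of_rk_lt Set.sdiff_subset ?_
    by_contra hcon
    refine h ((hS.subset_closure Set.sdiff_subset hcon).trans ?_)
    rw [Set.sdiff_sdiff_right_self]
    exact M.closure_subset_closure_of_subset_closure Set.inter_subset_right
  obtain ⟨T, hTS, hT⟩ := Set.exists_subset_card_eq (s := S \ M.closure X) (n := δ - 1) (by omega)
  -- `S \ T` still spans `S`, so the `δ - 1` elements of `T` are new but add no rank.
  have h2 : M.closure X ∪ S ⊆ M.closure (M.closure X ∪ (S \ M.closure X) \ T) := by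
    have h5 : M.closure X ⊆ M.closure (M.closure X ∪ (S \ M.closure X) \ T) :=
      M.subset_closure_of_subset' Set.subset_union_left
    refine Set.union_subset h5 ?_
    refine (hS.subset_closure (T := S \ T) Set.sdiff_subset ?_).trans ?_
    · rw [hS.rk_sdiff (hTS.trans Set.sdiff_subset) (by omega)]
      exact lt_irrefl _
    · refine M.closure_subset_closure fun x hx ↦ ?_
      by_cases hxc : x ∈ M.closure X
      · exact Or.inl hxc
      · exact Or.inr ⟨⟨hx.1, hxc⟩, hx.2⟩
  have h3 := rk_mono (M := M) h2
  have h4 := rk_union_le (M := M) (M.closure X) ((S \ M.closure X) \ T)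
  rw [rk_closure] at h3 h4
  have h5 := rk_le_ncard (M := M) (X := (S \ M.closure X) \ T)
    ((Set.sdiff_subset.trans Set.sdiff_subset).trans hS.subset_ground)
  have h6 := Set.ncard_sdiff_add_ncard_of_subset hTS (hfin.subset Set.sdiff_subset)
  have h7 : (M.closure X ∪ S).ncard = (M.closure X).ncard + (S \ M.closure X).ncard := by
    rw [← Set.union_sdiff_self, Set.ncard_union_eq Set.disjoint_sdiff_right hcfin
      (hfin.subset Set.sdiff_subset)]
  have h8 := Set.ncard_le_ncard (M.subset_closure X hX) hcfin
  unfold nullity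
  omega

end IsLocalitySet

namespace IsLRMatroid

lemma finite (hM : IsLRMatroid M n k d r δ) : M.Finite :=
  ⟨Set.finite_of_encard_eq_coe hM.encard_ground⟩

lemma ncard_ground (hM : IsLRMatroid M n k d r δ) : M.E.ncard = n := by
  rw [Set.ncard, hM.encard_ground, ENat.toNat_natCast]

lemma rk_ground (hM : IsLRMatroid M n k d r δ) : rk M M.E = k := by
  rw [rk, ← M.eRank_def, hM.eRank_eq, ENat.toNat_natCast]

lemma ncard_le_of_rk_lt (hM : IsLRMatroid M n k d r δ) (hX : X ⊆ M.E) (h : rk M X < k) :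
    X.ncard + d ≤ n := by
  have := hM.finite
  have h1 : minDist M ≤ (M.E \ X).encard := by
    refine iInf₂_le_of_le (M.E \ X) Set.sdiff_subset (iInf_le _ ?_)
    rw [Set.sdiff_sdiff_cancel_left hX, hM.eRank_eq, ← coe_rk, Nat.cast_lt]
    exact h
  rw [hM.minDist_eq, ← (M.ground_finite.subset Set.sdiff_subset).cast_ncard_eq,
    Nat.cast_le] at h1
  have h2 := Set.ncard_sdiff_add_ncard_of_subset hX M.ground_finite
  rw [hM.ncard_ground] at h2
  omega

lemma exists_mem_rk_insert (hM : IsLRMatroid M n k d r δ) (h : rk M X < k) :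
    ∃ y ∈ M.E \ X, rk M (insert y X) = rk M X + 1 := by
  have := hM.finite
  rw [← hM.rk_ground, ← Nat.cast_lt (α := ℕ∞), coe_rk, coe_rk] at h
  obtain ⟨y, hy, hy'⟩ := Matroid.exists_eRk_insert_eq_add_one_of_lt h
  refine ⟨y, hy, ?_⟩
  rw [← coe_rk, ← coe_rk] at hy'
  exact_mod_cast hy'

/-- Adding rank-raising elements up to rank `k - 1` does not lower the nullity, and a set of that
rank has at most `n - d` elements. -/
lemma nullity_le (hM : IsLRMatroid M n k d r δ) (hX : X ⊆ M.E) (h : rk M X < k) :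
    nullity M X ≤ n - d - k + 1 := by
  have := hM.finite
  obtain ⟨j, hj⟩ : ∃ j, rk M X + j + 1 = k := ⟨k - 1 - rk M X, by omega⟩
  induction j generalizing X with
  | zero =>
    have := hM.ncard_le_of_rk_lt hX h
    unfold nullity
    omega
  | succ j ih =>
    obtain ⟨y, hy, hy'⟩ := hM.exists_mem_rk_insert h
    have hX' : insert y X ⊆ M.E := Set.insert_subset hy.1 hX
    exact (nullity_mono (Set.subset_insert y X) hX').trans (ih hX' (by omega) (by omega))

/-- A set of small rank extends, by locality sets, to a set of small rank and large nullity. -/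
lemma exists_superset_nullity (hM : IsLRMatroid M n k d r δ) (hX : X ⊆ M.E) (j : ℕ)
    (h : rk M X + j * r < k) :
    ∃ Y ⊆ M.E, rk M Y < k ∧ nullity M X + j * (δ - 1) ≤ nullity M Y := by
  have := hM.finite
  have hδ := hM.two_le_delta
  induction j generalizing X with
  | zero => exact ⟨X, hX, by simpa using h, by simp⟩
  | succ j ih =>
    rw [add_one_mul] at h
    obtain ⟨y, hy, hy'⟩ := hM.exists_mem_rk_insert (X := M.closure X) (by
      rw [rk_closure]; omega)
    obtain ⟨S, hyS, hS⟩ := hM.locality y hy.1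
    have h1 := hS.nullity_closure_union hX (by omega) fun hsub ↦ hy.2 (hsub hyS)
    have h2 := rk_union_le (M := M) (M.closure X) S
    have h3 := hS.rk_le
    rw [rk_closure] at h2
    obtain ⟨Y, hY, hYk, hYn⟩ := ih (X := M.closure X ∪ S)
      (Set.union_subset (M.closure_subset_ground X) hS.subset_ground) (by omega)
    refine ⟨Y, hY, hYk, ?_⟩
    push_cast
    linarith

/-- The generalized Singleton bound. -/
lemma le_singletonBound (hM : IsLRMatroid M n k d r δ) {κ a : ℕ} (ha : k + a = κ * r)
    (har : a < r) : (d : ℤ) ≤ n - k + 1 - (κ - 1) * (δ - 1) := by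
  have := hM.finite
  obtain ⟨κ, rfl⟩ : ∃ κ', κ = κ' + 1 := ⟨κ - 1, by
    have : κ ≠ 0 := by
      rintro rfl
      have := hM.r_le
      omega
    omega⟩
  rw [add_one_mul] at ha
  obtain ⟨Y, hY, hYk, hYn⟩ := hM.exists_superset_nullity (Set.empty_subset _) κ (by
    rw [rk_empty]; omega)
  have h1 := hM.nullity_le hY hYk
  have h2 := nullity_nonneg (M := M) (Set.empty_subset _)
  push_cast
  linarith

/-- If the generalized Singleton bound is attained, the ground set is covered by small sets of which
any `κ` have almost full union. -/
theorem exists_cover (hM : IsLRMatroid M n k d r δ) {κ a : ℕ} (ha : k + a = κ * r)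
    (har : a < r) (hd : (d : ℤ) = n - k + 1 - (κ - 1) * (δ - 1)) [DecidableEq α] :
    ∃ C : Finset (Finset α), (∀ F ∈ C, F.card ≤ r + δ - 1) ∧ (C.biUnion id).card = n ∧
      ∀ I ⊆ C, I.card = κ → κ * (r + δ - 1) ≤ (I.biUnion id).card + a := by
  have := hM.finite
  have hδ := hM.two_le_delta
  have hrk := hM.r_le
  have hnull : ∀ X ⊆ M.E, rk M X < k → nullity M X ≤ (κ - 1) * (δ - 1) := fun X hX hXk ↦ by
    have := hM.nullity_le hX hXk
    linarith
  obtain ⟨E, hE⟩ : ∃ E : Finset α, (E : Set α) = M.E :=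
    ⟨M.ground_finite.toFinset, by simp⟩
  have hloc : ∀ x : α, ∃ F : Finset α, x ∈ E → x ∈ F ∧ IsLocalitySet M r δ (F : Set α) := by
    intro x
    by_cases hx : x ∈ E
    · obtain ⟨S, hxS, hS⟩ := hM.locality x (hE ▸ hx)
      refine ⟨(M.ground_finite.subset hS.subset_ground).toFinset, fun _ ↦ ?_⟩
      simpa using ⟨hxS, hS⟩
    · exact ⟨∅, fun h ↦ absurd h hx⟩
  choose F hF using hloc
  let P : Finset (Finset α) → Prop := fun C ↦
    (∀ S ∈ C, IsLocalitySet M r δ (S : Set α)) ∧ E ⊆ C.biUnion id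
  -- By minimality no member of `C` is covered by other members; this is `hirr`.
  obtain ⟨C, hC⟩ : ∃ C, Minimal P C := by
    refine exists_minimal_of_wellFoundedLT P ⟨E.image F, fun S hS ↦ ?_, fun x hx ↦ ?_⟩
    · obtain ⟨x, hx, rfl⟩ := Finset.mem_image.1 hS
      exact (hF x hx).2
    · exact Finset.mem_biUnion.2 ⟨F x, Finset.mem_image_of_mem F hx, (hF x hx).1⟩
  have hground : ∀ I ⊆ C, ((I.biUnion id : Finset α) : Set α) ⊆ M.E := fun I hI x hx ↦ by
    obtain ⟨S, hS, hxS⟩ := Finset.mem_biUnion.1 (Finset.mem_coe.1 hx)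
    exact (hC.prop.1 S (hI hS)).subset_ground hxS
  have hirr : ∀ I ⊆ C, ∀ S ∈ C, S ∉ I → ¬ S ⊆ I.biUnion id := by
    intro I hI S hS hSI hsub
    have h1 : P (C.erase S) := by
      refine ⟨fun T hT ↦ hC.prop.1 T (Finset.mem_of_mem_erase hT), fun x hx ↦ ?_⟩
      obtain ⟨T, hT, hxT⟩ := Finset.mem_biUnion.1 (hC.prop.2 hx)
      by_cases hTS : T = S
      · subst hTS
        obtain ⟨T', hT', hxT'⟩ := Finset.mem_biUnion.1 (hsub hxT)
        exact Finset.mem_biUnion.2 ⟨T', Finset.mem_erase.2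
          ⟨fun h ↦ hSI (h ▸ hT'), hI hT'⟩, hxT'⟩
      · exact Finset.mem_biUnion.2 ⟨T, Finset.mem_erase.2 ⟨hTS, hT⟩, hxT⟩
    exact (Finset.notMem_erase S C) (hC.le_of_le h1 (Finset.erase_subset S C) hS)
  have hrkI : ∀ I ⊆ C, rk M ((I.biUnion id : Finset α) : Set α) ≤ I.card * r := by
    intro I
    induction I using Finset.induction_on with
    | empty => simp [rk_empty]
    | insert S I hS ih =>
      intro hI
      rw [Finset.biUnion_insert, Finset.coe_union, Finset.card_insert_of_notMem hS, add_one_mul]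
      refine (rk_union_le _ _).trans ?_
      have h1 := ih ((Finset.subset_insert _ _).trans hI)
      have h2 := (hC.prop.1 S (hI (Finset.mem_insert_self _ _))).rk_le
      simp only [id] at *
      omega
  -- Fewer than `κ` members form a flat: a further element of the closure would add `1` to the
  -- nullity at no cost in rank, and `κ - 1 - I.card` more locality sets would then violate `hnull`.
  have hflat : ∀ I ⊆ C, I.card < κ →
      (I.card : ℤ) * (δ - 1) ≤ nullity M ((I.biUnion id : Finset α) : Set α) →
      M.closure ((I.biUnion id : Finset α) : Set α) ⊆ ((I.biUnion id : Finset α) : Set α) := by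
    intro I hI hIκ hIn x hx
    by_contra hxI
    obtain ⟨j, rfl⟩ : ∃ j, κ = I.card + j + 1 := ⟨κ - 1 - I.card, by omega⟩
    have h1 : rk M (insert x ((I.biUnion id : Finset α) : Set α)) =
        rk M ((I.biUnion id : Finset α) : Set α) := by
      rw [← rk_closure, Matroid.closure_insert_eq_of_mem_closure hx, rk_closure]
    have h2 := hrkI I hI
    rw [add_one_mul, add_mul] at ha
    obtain ⟨Y, hY, hYk, hYn⟩ := hM.exists_superset_nullity (j := j)
      (Set.insert_subset (M.closure_subset_ground _ hx) (hground I hI)) (by omega)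
    have h3 := hnull Y hY hYk
    have h4 : nullity M (insert x ((I.biUnion id : Finset α) : Set α)) =
        nullity M ((I.biUnion id : Finset α) : Set α) + 1 := by
      unfold nullity
      rw [h1, Set.ncard_insert_of_notMem hxI (Finset.finite_toSet _)]
      push_cast
      ring
    push_cast at h3
    nlinarith
  -- The union of the earlier members is a flat that does not contain the next one, so the next one
  -- adds nullity `δ - 1`.
  have hnullI : ∀ I ⊆ C, I.card ≤ κ →
      (I.card : ℤ) * (δ - 1) ≤ nullity M ((I.biUnion id : Finset α) : Set α) := by
    intro I
    induction I using Finset.induction_on with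
    | empty => intro _ _; simpa using nullity_nonneg (M := M) (Set.empty_subset _)
    | insert S I hS ih =>
      intro hI hcard
      rw [Finset.card_insert_of_notMem hS] at hcard ⊢
      have hI' := (Finset.subset_insert _ _).trans hI
      have hSC := hI (Finset.mem_insert_self _ _)
      have h1 := ih hI' (by omega)
      have h2 := hflat I hI' (by omega) h1
      have h3 := (hC.prop.1 S hSC).nullity_closure_union (hground I hI') (by omega) fun hsub ↦
        hirr I hI' S hSC hS (Finset.coe_subset.1 (hsub.trans h2))
      rw [h2.antisymm (M.subset_closure _ (hground I hI'))] at h3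
      rw [Finset.biUnion_insert, Finset.union_comm, Finset.coe_union]
      simp only [id] at *
      rw [Nat.cast_succ]
      linarith
  refine ⟨C, fun S hS ↦ ?_, ?_, fun I hI hIκ ↦ ?_⟩
  · rw [← Set.ncard_coe_finset]
    exact (hC.prop.1 S hS).ncard_le
  · have h1 : ((C.biUnion id : Finset α) : Set α) = M.E :=
      (hground C subset_rfl).antisymm (hE ▸ Finset.coe_subset.2 hC.prop.2)
    rw [← Set.ncard_coe_finset, h1, hM.ncard_ground]
  · have h1 := hnullI I hI hIκ.le
    -- Nullity `κ (δ - 1)` is too much for a nonspanning set.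
    have h2 : k ≤ rk M ((I.biUnion id : Finset α) : Set α) := by
      by_contra! h
      have h3 := hnull _ (hground I hI) h
      rw [hIκ] at h1
      have h4 : (2 : ℤ) ≤ δ := by exact_mod_cast hδ
      linarith
    unfold nullity at h1
    rw [Set.ncard_coe_finset, hIκ] at h1
    obtain ⟨ε, rfl⟩ : ∃ ε, δ = ε + 1 := ⟨δ - 1, by omega⟩
    have h5 : κ * (r + (ε + 1) - 1) = κ * r + κ * ε := by
      rw [← add_assoc, Nat.add_sub_cancel, mul_add]
    rw [h5]
    rw [Nat.cast_succ, add_sub_cancel_right] at h1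
    generalize rk M ((I.biUnion id : Finset α) : Set α) = ρ at h1 h2
    have h6 : κ * ε + ρ ≤ (I.biUnion id).card := by
      zify
      linarith
    omega

end IsLRMatroid

end UpperBound

/-! ### Deficiency and tree components. -/

section Deficiency

variable {α ι : Type*} [DecidableEq α] {S : ι → Finset α} {N : ℕ}
  {C I J K : Finset ι}

/-- The amount by which the union of the sets `S i`, `i ∈ I`, falls short of `N` per set. -/
def deficiency (S : ι → Finset α) (N : ℕ) (I : Finset ι) : ℤ :=
  (I.card : ℤ) * N - (I.biUnion S).card

lemma deficiency_nonneg (hS : ∀ i ∈ I, (S i).card ≤ N) : 0 ≤ deficiency S N I := by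
  have := Finset.card_biUnion_le_card_mul I S N hS
  unfold deficiency
  zify at this
  linarith

variable [DecidableEq ι]

lemma deficiency_union (hIJ : Disjoint I J) (h : Disjoint (I.biUnion S) (J.biUnion S)) :
    deficiency S N (I ∪ J) = deficiency S N I + deficiency S N J := by
  unfold deficiency
  rw [Finset.union_biUnion, Finset.card_union_of_disjoint hIJ, Finset.card_union_of_disjoint h]
  push_cast
  ring

lemma deficiency_insert_ge {i : ι} (hi : i ∉ I) (hS : (S i).card ≤ N)
    (h : ¬ Disjoint (S i) (I.biUnion S)) :
    deficiency S N I + 1 ≤ deficiency S N (insert i I) := by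
  unfold deficiency
  rw [Finset.biUnion_insert, Finset.card_insert_of_notMem hi]
  have h1 := Finset.card_union_add_card_inter (S i) (I.biUnion S)
  have h2 : 0 < (S i ∩ I.biUnion S).card := by
    rw [Finset.card_pos, ← Finset.not_disjoint_iff_nonempty_inter]
    exact h
  push_cast
  rw [add_one_mul]
  omega

/-- Every cardinality up to `#J` is attained by a subset of deficiency at least that of a tree. -/
def HasTreeSubsets (S : ι → Finset α) (N : ℕ) (J : Finset ι) : Prop :=
  ∀ m ≤ J.card, ∃ K ⊆ J, K.card = m ∧ (m : ℤ) - 1 ≤ deficiency S N K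

/-- Starting from `{i}`, each added set that meets the current union raises the deficiency by at
least one. A largest family grown this way is disjoint from the remaining sets, and its growth
provides the subsets of every size. -/
lemma exists_component (hS : ∀ i ∈ C, (S i).card ≤ N) {i : ι} (hi : i ∈ C) :
    ∃ J ⊆ C, i ∈ J ∧ HasTreeSubsets S N J ∧ (J.card : ℤ) - 1 ≤ deficiency S N J ∧
      Disjoint (J.biUnion S) ((C \ J).biUnion S) := by
  classical
  let P : Finset ι → Prop := fun J ↦
    J ⊆ C ∧ i ∈ J ∧ HasTreeSubsets S N J ∧ (J.card : ℤ) - 1 ≤ deficiency S N J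
  have hP : P {i} := by
    have h1 : 0 ≤ deficiency S N {i} := deficiency_nonneg (by simpa using hS i hi)
    refine ⟨by simpa using hi, Finset.mem_singleton_self i, fun m hm ↦ ?_, by simpa using h1⟩
    rw [Finset.card_singleton] at hm
    interval_cases m
    · exact ⟨∅, Finset.empty_subset _, rfl, by simp [deficiency]⟩
    · exact ⟨{i}, subset_rfl, rfl, by simpa using h1⟩
  obtain ⟨J, hJ, hmax⟩ := Finset.exists_max_image (C.powerset.filter P) Finset.card
    ⟨{i}, Finset.mem_filter.2 ⟨Finset.mem_powerset.2 hP.1, hP⟩⟩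
  obtain ⟨hJC, hiJ, hJt, hJd⟩ := (Finset.mem_filter.1 hJ).2
  refine ⟨J, hJC, hiJ, hJt, hJd, ?_⟩
  rw [Finset.disjoint_biUnion_right]
  intro j hj
  rw [Finset.mem_sdiff] at hj
  by_contra hdis
  have h1 := deficiency_insert_ge hj.2 (hS j hj.1) fun h ↦ hdis h.symm
  have hcard := Finset.card_insert_of_notMem hj.2
  have hd : ((insert j J).card : ℤ) - 1 ≤ deficiency S N (insert j J) := by
    rw [hcard]
    push_cast
    linarith
  have h2 : P (insert j J) := by
    refine ⟨Finset.insert_subset hj.1 hJC, Finset.mem_insert_of_mem hiJ, fun m hm ↦ ?_, hd⟩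
    rcases hm.eq_or_lt with rfl | hlt
    · exact ⟨insert j J, subset_rfl, rfl, hd⟩
    · obtain ⟨K, hK, hK'⟩ := hJt m (by omega)
      exact ⟨K, hK.trans (Finset.subset_insert _ _), hK'⟩
  have h3 := hmax (insert j J) (Finset.mem_filter.2 ⟨Finset.mem_powerset.2 h2.1, h2⟩)
  omega

/-- If all tree components have at least `t + 2` members, then there are sets of every cardinality
`m` with few tree components. -/
lemma exists_subset_deficiency_ge (t : ℕ) (hS : ∀ i ∈ C, (S i).card ≤ N)
    (h : ∀ J ⊆ C, J.Nonempty → HasTreeSubsets S N J → deficiency S N J ≤ J.card - 1 →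
      Disjoint (J.biUnion S) ((C \ J).biUnion S) → t + 2 ≤ J.card) {m : ℕ} (hm : m ≤ C.card) :
    ∃ J ⊆ C, ∃ q : ℤ, J.card = m ∧ (m : ℤ) - q ≤ deficiency S N J ∧
      (q - 1) * (t + 2) ≤ m - 1 := by
  induction C using Finset.strongInduction generalizing m with
  | H C ih =>
    rcases Nat.eq_zero_or_pos m with rfl | hmpos
    · exact ⟨∅, Finset.empty_subset _, 0, rfl, by simp [deficiency], by push_cast; linarith⟩
    obtain ⟨i, hi⟩ := Finset.card_pos.1 (hmpos.trans_le hm)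
    obtain ⟨J, hJC, hiJ, hJt, hJd, hJdis⟩ := exists_component hS hi
    -- Whole components are collected until the last one is only partly needed. `q` counts the tree
    -- components used, together with that partial one, which need not have `t + 2` members; hence
    -- `q - 1`.
    rcases le_or_gt m J.card with hmJ | hmJ
    · obtain ⟨K, hKJ, hK, hKd⟩ := hJt m hmJ
      exact ⟨K, hKJ.trans hJC, 1, hK, hKd, by simp only [sub_self, zero_mul]; omega⟩
    have hcard := Finset.card_sdiff_add_card_eq_card hJC
    obtain ⟨K, hK, q, hKm, hKd, hq⟩ := ih (C \ J)
      (Finset.sdiff_ssubset hJC ⟨i, hiJ⟩)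
      (fun i hi ↦ hS i (Finset.sdiff_subset hi))
      (fun L hL hne hLt hLd hLdis ↦ h L (hL.trans Finset.sdiff_subset) hne hLt hLd (by
        rw [Finset.disjoint_biUnion_right] at hLdis ⊢
        intro j hj
        rw [Finset.mem_sdiff] at hj
        by_cases hjJ : j ∈ J
        · exact (hJdis.mono (Finset.subset_biUnion_of_mem S hjJ)
            (Finset.biUnion_subset_biUnion_of_subset_left S hL)).symm
        · exact hLdis j (Finset.mem_sdiff.2 ⟨Finset.mem_sdiff.2 ⟨hj.1, hjJ⟩, hj.2⟩)))
      (m := m - J.card) (by omega)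
    have hJK : Disjoint J K := Finset.disjoint_sdiff.mono_right hK
    have hdef := deficiency_union (S := S) (N := N) hJK
      (hJdis.mono_right (Finset.biUnion_subset_biUnion_of_subset_left S hK))
    have hcardJK := Finset.card_union_of_disjoint hJK
    push_cast [hmJ.le] at hKd hq
    by_cases hJtree : deficiency S N J ≤ J.card - 1
    · have h1 := h J hJC ⟨i, hiJ⟩ hJt hJtree hJdis
      refine ⟨J ∪ K, Finset.union_subset hJC (hK.trans Finset.sdiff_subset), q + 1, by omega,
        by rw [hdef]; linarith, ?_⟩
      zify at h1
      linarith
    · refine ⟨J ∪ K, Finset.union_subset hJC (hK.trans Finset.sdiff_subset), q, by omega,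
        by rw [hdef]; push Not at hJtree; omega, ?_⟩
      have : (0 : ℤ) ≤ J.card := by positivity
      linarith

/-- If unions of `κ` of the sets have deficiency at most `a < κ - 1`, then the deficiency of the
whole family is that of a forest with small components. -/
theorem deficiency_le {κ a t : ℕ} (hS : ∀ i ∈ C, (S i).card ≤ N)
    (hκ : ∀ I ⊆ C, I.card = κ → deficiency S N I ≤ a)
    (ht : (κ : ℤ) - 1 < (t + 2) * (κ - 1 - a)) (hC : κ ≤ C.card) :
    (t + 1) * (deficiency S N C - a) ≤ t * (C.card - κ + 1) := by
  induction C using Finset.strongInduction with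
  | H C ih =>
    rcases hC.eq_or_lt with hC' | hC'
    · have h1 := hκ C subset_rfl hC'.symm
      rw [← hC']
      nlinarith
    -- Some tree component has at most `t + 1` members, since otherwise `κ` sets with few tree
    -- components would have deficiency above `a`. Removing it costs deficiency at most `J.card -
    -- 1`, and `(t + 1) * (J.card - 1) ≤ t * J.card`.
    obtain ⟨J, hJC, hJne, hJt, hJd, hJdis, hJcard⟩ : ∃ J ⊆ C, J.Nonempty ∧ HasTreeSubsets S N J ∧
        deficiency S N J ≤ J.card - 1 ∧ Disjoint (J.biUnion S) ((C \ J).biUnion S) ∧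
        J.card < t + 2 := by
      by_contra! hcon
      obtain ⟨J, hJC, q, hJκ, hJd, hq⟩ := exists_subset_deficiency_ge t hS
        (fun J h1 h2 h3 h4 h5 ↦ hcon J h1 h2 h3 h4 h5) hC
      have h1 := hκ J hJC hJκ
      nlinarith
    have hcard := Finset.card_sdiff_add_card_eq_card hJC
    have hJpos := hJne.card_pos
    have hdef : deficiency S N C = deficiency S N J + deficiency S N (C \ J) := by
      rw [← deficiency_union Finset.disjoint_sdiff hJdis, Finset.union_sdiff_of_subset hJC]
    rcases le_or_gt κ (C \ J).card with hle | hlt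
    · have h1 := ih (C \ J) (Finset.sdiff_ssubset hJC hJne)
        (fun i hi ↦ hS i (Finset.sdiff_subset hi))
        (fun I hI ↦ hκ I (hI.trans Finset.sdiff_subset)) hle
      rw [hdef, ← hcard]
      push_cast
      zify at hJcard
      nlinarith
    -- Fewer than `κ` sets remain, so a tree part `K` of `J` fills them up to exactly `κ`. The
    -- excess deficiency is then at most `C.card - κ`, which is at most `t`.
    · obtain ⟨K, hKJ, hK, hKd⟩ := hJt (κ - (C \ J).card) (by omega)
      have hdis : Disjoint K (C \ J) := Finset.disjoint_sdiff.mono_left hKJ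
      have h1 := hκ (K ∪ C \ J) (Finset.union_subset (hKJ.trans hJC) Finset.sdiff_subset) (by
        rw [Finset.card_union_of_disjoint hdis]; omega)
      rw [deficiency_union hdis
        (hJdis.mono_left (Finset.biUnion_subset_biUnion_of_subset_left S hKJ))] at h1
      push_cast [hlt.le] at hKd
      have h2 : deficiency S N C - a ≤ C.card - κ := by
        rw [hdef]
        zify at hcard
        linarith
      have h3 : (C.card : ℤ) - κ ≤ t := by omega
      nlinarith

end Deficiency

/-! ### The star construction for `a < κ - 1`. -/

/-- Sets of equal size grouped into classes, the sets of a class sharing one common element, give a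
design. -/
theorem exists_mem_distances_of_classes {n k r δ κ ν a b p : ℕ} (hδ : 2 ≤ δ) (hrk : r < k)
    (ha : k + a = κ * r) (har : a < r) (hb : n + b = ν * (r + δ - 1)) (hκν : κ ≤ ν)
    (hp : p + b = ν) {c : Fin ν → Fin p} (hc : Function.Surjective c)
    (hI : ∀ I : Finset (Fin ν), κ ≤ I.card → κ ≤ (I.image c).card + a) :
    ∃ d : ℕ, (n : ℤ) - k + 1 - (κ - 1) * (δ - 1) ≤ d ∧ d ∈ distances n k r δ := by
  obtain ⟨ε, rfl⟩ : ∃ ε, δ = ε + 1 := ⟨δ - 1, by omega⟩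
  obtain ⟨r, rfl⟩ : ∃ r', r = r' + 1 := ⟨r - 1, by omega⟩
  let S : Fin ν → Finset (Fin p ⊕ Fin ν × Fin (r + ε)) := fun i ↦
    ({c i} : Finset (Fin p)).disjSum (({i} : Finset (Fin ν)) ×ˢ Finset.univ)
  have hS : ∀ I : Finset (Fin ν), I.biUnion S = (I.image c).disjSum (I ×ˢ Finset.univ) := by
    intro I
    ext x
    rcases x with x | ⟨x, y⟩
    · simp only [S, Finset.mem_biUnion, Finset.inl_mem_disjSum, Finset.mem_singleton,
        Finset.mem_image, eq_comm]
    · simp [S]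
  have hcard : ∀ I : Finset (Fin ν),
      (I.biUnion S).card = (I.image c).card + I.card * (r + ε) := fun I ↦ by
    rw [hS, Finset.card_disjSum, Finset.card_product, Finset.card_univ, Fintype.card_fin]
  have hn : Fintype.card (Fin p ⊕ Fin ν × Fin (r + ε)) = n := by
    rw [Fintype.card_sum, Fintype.card_prod, Fintype.card_fin, Fintype.card_fin, Fintype.card_fin]
    have : ν * (r + 1 + (ε + 1) - 1) = ν * (r + ε) + ν := by
      rw [← mul_add_one]; congr 1; omega
    omega
  rw [← hn]
  refine exists_mem_distances_of_design S hδ hrk (by simpa using hκν) ha har (fun x ↦ ?_)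
    (fun i ↦ ?_) fun I hIκ ↦ ?_
  · rcases x with x | ⟨x, y⟩
    · obtain ⟨i, rfl⟩ := hc x
      exact ⟨i, by simp [S]⟩
    · exact ⟨x, by simp [S]⟩
  · simp only [S, Finset.card_disjSum, Finset.card_product, Finset.card_singleton,
      Finset.card_univ, Fintype.card_fin]
    omega
  · rw [hcard]
    have h1 := hI I hIκ
    have h2 : κ * r ≤ I.card * r := Nat.mul_le_mul_right r hIκ
    rw [mul_add_one] at ha
    rw [Nat.add_sub_cancel, mul_add]
    omega

/-- A set of `ν` elements can be divided into `p` nonempty classes, all of size at most `t + 1`,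
except for one which may have `e` more elements. -/
lemma exists_surjective_card_fiber_le {ν p t e : ℕ} (ht : 0 < t) (hp : 0 < p) (hpν : p ≤ ν)
    (h : ν ≤ p * (t + 1) + e) :
    ∃ c : Fin ν → Fin p, Function.Surjective c ∧ ∀ y : Fin p,
      (Finset.univ.filter fun i ↦ c i = y).card ≤ t + 1 + if y = ⟨0, hp⟩ then e else 0 := by
  -- The first `p` elements represent the classes. Truncated subtraction sends the next `e` to class
  -- `0`, and the rest are dealt out `t` at a time.
  have hlt : ∀ i : Fin ν, (if (i : ℕ) < p then (i : ℕ) else (i - p - e) / t) < p := by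
    intro i
    split_ifs with hi
    · exact hi
    · rw [Nat.div_lt_iff_lt_mul ht]
      rw [mul_add_one] at h
      have := i.2
      have : 0 < p * t := Nat.mul_pos hp ht
      omega
  refine ⟨fun i ↦ ⟨_, hlt i⟩, fun y ↦ ⟨⟨y, y.2.trans_le hpν⟩, ?_⟩, fun y ↦ ?_⟩
  · ext
    simp
  · rw [← Finset.card_map Fin.valEmbedding]
    have hsub : (Finset.univ.filter fun i : Fin ν ↦ (⟨_, hlt i⟩ : Fin p) = y).map
        Fin.valEmbedding ⊆ insert (y : ℕ) (Finset.Ico (p + e + y * t) (p + e + y * t + t)) ∪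
          (if y = ⟨0, hp⟩ then Finset.Ico p (p + e) else ∅) := by
      intro x hx
      simp only [Finset.mem_map, Finset.mem_filter, Finset.mem_univ, true_and,
        Fin.valEmbedding_apply, Fin.ext_iff] at hx
      obtain ⟨i, hi, rfl⟩ := hx
      simp only [Finset.mem_union, Finset.mem_insert, Finset.mem_Ico]
      by_cases hip : (i : ℕ) < p
      · rw [if_pos hip] at hi
        exact Or.inl (Or.inl hi)
      rw [if_neg hip] at hi
      by_cases hie : (i : ℕ) < p + e
      · right
        have h0 : (i : ℕ) - p - e = 0 := by omega
        rw [h0, Nat.zero_div] at hi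
        rw [if_pos (Fin.ext hi.symm)]
        exact Finset.mem_Ico.2 ⟨by omega, hie⟩
      · left
        right
        have h1 := Nat.div_add_mod (i - p - e : ℕ) t
        have h2 := Nat.mod_lt (i - p - e : ℕ) ht
        rw [hi, mul_comm] at h1
        omega
    refine (Finset.card_le_card hsub).trans ((Finset.card_union_le _ _).trans ?_)
    refine Nat.add_le_add ((Finset.card_insert_le _ _).trans ?_) ?_
    · rw [Nat.card_Ico]
      omega
    · split_ifs <;> simp

/-- The sufficiency of the conditions for `a < κ - 1`. -/
theorem exists_mem_distances_of_forest {n k r δ κ ν a b t : ℕ} (hδ : 2 ≤ δ) (hrk : r < k)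
    (ha : k + a = κ * r) (har : a < r) (hb : n + b = ν * (r + δ - 1)) (hκν : κ ≤ ν)
    (haκ : a + 1 < κ) (ht : 0 < t) (hta : (t : ℤ) * (κ - 1 - a) ≤ a)
    (hν : ((b : ℤ) - a) * (t + 1) ≤ t * (ν - κ + 1)) :
    ∃ d : ℕ, (n : ℤ) - k + 1 - (κ - 1) * (δ - 1) ≤ d ∧ d ∈ distances n k r δ := by
  obtain ⟨q, rfl⟩ : ∃ q, κ = a + 1 + q := ⟨κ - (a + 1), by omega⟩
  obtain ⟨e, he⟩ : ∃ e : ℕ, a = q * t + e := ⟨a - q * t, by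
    have : q * t ≤ a := by
      zify
      push_cast at hta
      linarith
    omega⟩
  have hbν : b < ν := by
    by_contra! h
    push_cast at hν
    zify at h haκ ht
    nlinarith
  obtain ⟨p, hp⟩ : ∃ p, p + b = ν := ⟨ν - b, by omega⟩
  -- With `p = ν - b` and `e = a - q * t` this is a rearrangement of `hν`.
  have hle : ν ≤ p * (t + 1) + e := by
    zify at hp he ⊢
    push_cast at hν
    rw [← hp] at hν ⊢
    nlinarith
  obtain ⟨c, hc, hfib⟩ := exists_surjective_card_fiber_le (p := p) ht (by omega) (by omega) hle
  refine exists_mem_distances_of_classes hδ hrk ha har hb hκν hp hc fun I hI ↦ ?_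
  have h1 : I.card ≤ (I.image c).card * (t + 1) + e := by
    rw [Finset.card_eq_sum_card_image c I]
    calc ∑ y ∈ I.image c, (I.filter fun i ↦ c i = y).card
        ≤ ∑ y ∈ I.image c, (t + 1 + if y = ⟨0, by omega⟩ then e else 0) :=
          Finset.sum_le_sum fun y _ ↦ (Finset.card_le_card
            (Finset.filter_subset_filter _ (Finset.subset_univ I))).trans (hfib y)
      _ ≤ (I.image c).card * (t + 1) + e := by
          rw [Finset.sum_add_distrib, Finset.sum_const, smul_eq_mul, Finset.sum_ite_eq']
          split_ifs <;> omega
  -- At most `q` classes hold at most `q * (t + 1) + e = a + q = κ - 1` sets.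
  by_contra! hcon
  have h2 : (I.image c).card ≤ q := by omega
  have h3 := Nat.mul_le_mul_right (t + 1) h2
  rw [mul_add_one q] at h3
  omega

/-! ### Designs from multigraphs. -/

section Multigraph

variable {V : Type*} [DecidableEq V] {b : ℕ} (src tgt : Fin b → V)

/-- The edges with an end in `I`. -/
def edgesAt (I : Finset V) : Finset (Fin b) := Finset.univ.filter fun p ↦ src p ∈ I ∨ tgt p ∈ I

/-- The edges with both ends in `I`. -/
def edgesIn (I : Finset V) : Finset (Fin b) := Finset.univ.filter fun p ↦ src p ∈ I ∧ tgt p ∈ I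

variable {src tgt}

lemma sum_card_edgesAt (hne : ∀ p, src p ≠ tgt p) (I : Finset V) :
    ∑ i ∈ I, (edgesAt src tgt {i}).card = (edgesAt src tgt I).card + (edgesIn src tgt I).card := by
  simp only [edgesAt, edgesIn, Finset.card_filter, Finset.mem_singleton]
  rw [Finset.sum_comm, ← Finset.sum_add_distrib]
  refine Finset.sum_congr rfl fun p _ ↦ ?_
  have h1 : ∀ i, (if src p = i ∨ tgt p = i then 1 else 0) =
      (if src p = i then 1 else 0) + if tgt p = i then 1 else 0 := by
    intro i
    have := hne p
    by_cases h1 : src p = i <;> by_cases h2 : tgt p = i <;> simp [h1, h2]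
    exact this (h1.trans h2.symm)
  simp only [h1, Finset.sum_add_distrib, Finset.sum_ite_eq]
  by_cases h2 : src p ∈ I <;> by_cases h3 : tgt p ∈ I <;> simp [h2, h3]

/-- Each vertex beyond a chosen `κ` of them brings at most `r` edges. This reduces the design
condition for larger families to families of exactly `κ` members. -/
lemma card_edgesIn_le {r κ a : ℕ} (hdeg : ∀ v, (edgesAt src tgt {v}).card ≤ r)
    (hκ : ∀ I : Finset V, I.card = κ → (edgesIn src tgt I).card ≤ a) {I : Finset V}
    (hI : κ ≤ I.card) : (edgesIn src tgt I).card + r * κ ≤ a + r * I.card := by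
  obtain ⟨J, hJI, hJ⟩ := Finset.exists_subset_card_eq hI
  have h1 : edgesIn src tgt I ⊆
      edgesIn src tgt J ∪ (I \ J).biUnion fun v ↦ edgesAt src tgt {v} := by
    intro p hp
    simp only [edgesIn, edgesAt, Finset.mem_filter, Finset.mem_univ, true_and, Finset.mem_union,
      Finset.mem_biUnion, Finset.mem_sdiff, Finset.mem_singleton] at hp ⊢
    by_cases h1 : src p ∈ J
    · by_cases h2 : tgt p ∈ J
      · exact Or.inl ⟨h1, h2⟩
      · exact Or.inr ⟨tgt p, ⟨hp.2, h2⟩, Or.inr rfl⟩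
    · exact Or.inr ⟨src p, ⟨hp.1, h1⟩, Or.inl rfl⟩
  have h2 := (Finset.card_le_card h1).trans (Finset.card_union_le _ _)
  have h3 := Finset.card_biUnion_le_card_mul (I \ J) (fun v ↦ edgesAt src tgt {v}) r
    fun v _ ↦ hdeg v
  have h4 := Finset.card_sdiff_add_card_eq_card hJI
  have h5 := hκ J hJ
  rw [← h4, hJ, mul_add, mul_comm r (I \ J).card]
  omega

end Multigraph

/-- A multigraph with `ν` vertices, `b` edges, degrees at most `r` and at most `a` edges among any
`κ` vertices gives a design: the set attached to a vertex consists of the edges at the vertex and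
of private elements. -/
theorem exists_mem_distances_of_multigraph {ι : Type} [Fintype ι] [DecidableEq ι]
    {n k r δ κ a b : ℕ} (hδ : 2 ≤ δ) (hrk : r < k)
    (ha : k + a = κ * r) (har : a < r) (hb : n + b = Fintype.card ι * (r + δ - 1))
    (hκν : κ ≤ Fintype.card ι) {src tgt : Fin b → ι} (hne : ∀ p, src p ≠ tgt p)
    (hdeg : ∀ v, (edgesAt src tgt {v}).card ≤ r)
    (hκ : ∀ I : Finset ι, I.card = κ → (edgesIn src tgt I).card ≤ a) :
    ∃ d : ℕ, (n : ℤ) - k + 1 - (κ - 1) * (δ - 1) ≤ d ∧ d ∈ distances n k r δ := by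
  obtain ⟨ε, rfl⟩ : ∃ ε, δ = ε + 1 := ⟨δ - 1, by omega⟩
  rw [← add_assoc, Nat.add_sub_cancel] at hb
  let c : ι → ℕ := fun i ↦ r + ε - (edgesAt src tgt {i}).card
  let S : ι → Finset (Fin b ⊕ Σ i, Fin (c i)) := fun i ↦
    (edgesAt src tgt {i}).disjSum (block c i)
  have hS : ∀ I : Finset ι, I.biUnion S = (edgesAt src tgt I).disjSum (I.biUnion (block c)) := by
    intro I
    ext x
    rcases x with x | x
    · simp only [S, edgesAt, Finset.mem_biUnion, Finset.inl_mem_disjSum, Finset.mem_singleton,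
        Finset.mem_filter, Finset.mem_univ, true_and]
      constructor
      · rintro ⟨i, hi, rfl | rfl⟩
        · exact Or.inl hi
        · exact Or.inr hi
      · rintro (h | h)
        · exact ⟨_, h, Or.inl rfl⟩
        · exact ⟨_, h, Or.inr rfl⟩
    · simp only [S, Finset.mem_biUnion, Finset.inr_mem_disjSum]
  -- An edge is shared by the sets of its two ends only, so the deficiency of `I` is the number of
  -- edges it spans.
  have hcard : ∀ I : Finset ι,
      (I.biUnion S).card + (edgesIn src tgt I).card = I.card * (r + ε) := fun I ↦ by
    rw [hS, Finset.card_disjSum, card_biUnion_block]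
    have h1 := sum_card_edgesAt hne I
    have h2 : ∑ i ∈ I, c i + ∑ i ∈ I, (edgesAt src tgt {i}).card = I.card * (r + ε) := by
      rw [← Finset.sum_add_distrib, ← smul_eq_mul, ← Finset.sum_const]
      refine Finset.sum_congr rfl fun i _ ↦ ?_
      have := hdeg i
      simp only [c]
      omega
    omega
  have hcover : ∀ x, ∃ i, x ∈ S i := by
    rintro (x | x)
    · exact ⟨src x, by simp [S, edgesAt]⟩
    · exact ⟨x.1, by simp only [S, Finset.inr_mem_disjSum]; exact mem_block c x⟩
  have hn : Fintype.card (Fin b ⊕ Σ i, Fin (c i)) = n := by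
    have h1 := hcard Finset.univ
    have h2 : Finset.univ.biUnion S = Finset.univ :=
      Finset.eq_univ_of_forall fun x ↦ by simpa using hcover x
    have h3 : edgesIn src tgt Finset.univ = Finset.univ := by simp [edgesIn]
    rw [h2, h3, Finset.card_univ, Finset.card_univ, Finset.card_univ, Fintype.card_fin] at h1
    omega
  rw [← hn]
  refine exists_mem_distances_of_design S hδ hrk hκν ha har hcover (fun i ↦ ?_) fun I hI ↦ ?_
  · have := hcard {i}
    rw [Finset.singleton_biUnion, Finset.card_singleton, one_mul] at this
    omega
  · have h1 := hcard I
    have h2 := card_edgesIn_le hdeg hκ hI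
    rw [Nat.add_sub_cancel]
    rw [mul_add, mul_comm _ r] at h1
    rw [mul_comm κ] at ha
    omega

lemma card_filter_div_mem_le {b s : ℕ} (hs : 0 < s) (T : Finset ℕ) :
    (Finset.univ.filter fun p : Fin b ↦ (p : ℕ) / s ∈ T).card ≤ T.card * s := by
  rw [← Finset.card_map Fin.valEmbedding]
  refine (Finset.card_le_card (t := T.biUnion fun j ↦ Finset.Ico (j * s) (j * s + s)) ?_).trans
    (Finset.card_biUnion_le_card_mul _ _ _ fun j _ ↦ by simp)
  intro x hx
  simp only [Finset.mem_map, Finset.mem_filter, Finset.mem_univ, true_and,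
    Fin.valEmbedding_apply] at hx
  obtain ⟨p, hp, rfl⟩ := hx
  refine Finset.mem_biUnion.2 ⟨_, hp, Finset.mem_Ico.2 ⟨Nat.div_mul_le_self _ _, ?_⟩⟩
  have h1 := Nat.div_add_mod (p : ℕ) s
  have h2 := Nat.mod_lt (p : ℕ) hs
  rw [mul_comm] at h1
  omega

/-- A graph with edges `f j`, `g j`, of which the first ones are taken with multiplicity `s`, gives
a design. -/
theorem exists_mem_distances_of_graph {V : Type} [DecidableEq V] [Infinite V]
    {n k r δ κ ν a b s : ℕ} (hδ : 2 ≤ δ) (hrk : r < k)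
    (ha : k + a = κ * r) (har : a < r) (hb : n + b = ν * (r + δ - 1)) (hκν : κ ≤ ν) (hs : 0 < s)
    {f g : ℕ → V} (hne : ∀ j, f j ≠ g j) {W : Finset V} (hW : W.card ≤ ν)
    (hfW : ∀ j, j * s < b → f j ∈ W) (hgW : ∀ j, j * s < b → g j ∈ W)
    (hdeg : ∀ v, ∃ T : Finset ℕ, T.card * s ≤ r ∧ ∀ j, f j = v ∨ g j = v → j ∈ T)
    (hκ : ∀ I : Finset V, I.card = κ →
      ∃ T : Finset ℕ, T.card * s ≤ a ∧ ∀ j, f j ∈ I → g j ∈ I → j ∈ T) :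
    ∃ d : ℕ, (n : ℤ) - k + 1 - (κ - 1) * (δ - 1) ≤ d ∧ d ∈ distances n k r δ := by
  -- Isolated vertices pad `W` to exactly `ν`. The multigraph edge `p` is a copy of the simple edge
  -- `p / s`, the last of which may have fewer than `s` copies.
  obtain ⟨W', hWW', hW'⟩ := Infinite.exists_superset_card_eq W ν hW
  have hcard : Fintype.card W' = ν := by rw [Fintype.card_coe, hW']
  have hdiv : ∀ p : Fin b, (p : ℕ) / s * s < b := fun p ↦ (Nat.div_mul_le_self _ _).trans_lt p.2
  refine exists_mem_distances_of_multigraph (ι := W') hδ hrk ha har (by rwa [hcard])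
    (by rwa [hcard])
    (src := fun p : Fin b ↦ ⟨f (p / s), hWW' (hfW _ (hdiv p))⟩)
    (tgt := fun p : Fin b ↦ ⟨g (p / s), hWW' (hgW _ (hdiv p))⟩)
    (fun p h ↦ hne _ (Subtype.ext_iff.1 h)) (fun v ↦ ?_) fun I hI ↦ ?_
  · obtain ⟨T, hT, hT'⟩ := hdeg v
    refine (Finset.card_le_card fun p hp ↦ ?_).trans ((card_filter_div_mem_le hs T).trans hT)
    simp only [edgesAt, Finset.mem_filter, Finset.mem_univ, true_and, Finset.mem_singleton,
      Subtype.ext_iff] at hp ⊢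
    exact hT' _ hp
  · obtain ⟨T, hT, hT'⟩ := hκ (I.map (Function.Embedding.subtype _)) (by rw [Finset.card_map, hI])
    refine (Finset.card_le_card fun p hp ↦ ?_).trans ((card_filter_div_mem_le hs T).trans hT)
    simp only [edgesIn, Finset.mem_filter, Finset.mem_univ, true_and] at hp ⊢
    exact hT' _ (Finset.mem_map.2 ⟨_, hp.1, rfl⟩) (Finset.mem_map.2 ⟨_, hp.2, rfl⟩)

/-- For `κ = 2`, a path whose edges have multiplicity `s` gives a design. -/
theorem exists_mem_distances_of_path {n k r δ ν a b s : ℕ} (hδ : 2 ≤ δ) (hrk : r < k)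
    (ha : k + a = 2 * r) (har : a < r) (hb : n + b = ν * (r + δ - 1)) (hκν : 2 ≤ ν) (hs : 0 < s)
    (hsa : s ≤ a) (hsr : 2 * s ≤ r) (hν : b ≤ (ν - 1) * s) :
    ∃ d : ℕ, (n : ℤ) - k + 1 - (2 - 1) * (δ - 1) ≤ d ∧ d ∈ distances n k r δ := by
  have hlt : ∀ j, j * s < b → j < ν - 1 := fun j hj ↦
    Nat.lt_of_mul_lt_mul_right (hj.trans_le hν)
  refine exists_mem_distances_of_graph (κ := 2) (V := ℕ) hδ hrk ha har hb hκν hs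
    (f := fun j ↦ j) (g := fun j ↦ j + 1) (fun j ↦ by omega) (W := Finset.range ν) (by simp)
    (fun j hj ↦ by have := hlt j hj; rw [Finset.mem_range]; omega)
    (fun j hj ↦ by have := hlt j hj; rw [Finset.mem_range]; omega) (fun v ↦ ?_) fun I hI ↦ ?_
  · refine ⟨{v, v - 1}, (Nat.mul_le_mul_right s Finset.card_le_two).trans hsr, fun j hj ↦ ?_⟩
    simp only [Finset.mem_insert, Finset.mem_singleton]
    omega
  · obtain ⟨x, y, hxy, rfl⟩ := Finset.card_eq_two.1 hI
    refine ⟨{min x y}, by simpa using hsa, fun j h1 h2 ↦ ?_⟩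
    simp only [Finset.mem_insert, Finset.mem_singleton] at h1 h2 ⊢
    omega

/-! ### Theta graphs. -/

section Theta

variable {t u : ℕ}

/-- The vertex at height `i` on the path `q` of the theta graph `c`, all of whose paths have `u`
edges and common ends. -/
def thetaVertex (u c q i : ℕ) : ℕ × ℕ × ℕ := if i = 0 ∨ i = u then (c, 0, i) else (c, q, i)

/-- The lower end of the edge `j` in a sequence of theta graphs with `t` paths of `u` edges. -/
def thetaSrc (t u j : ℕ) : ℕ × ℕ × ℕ := thetaVertex u (j / u / t) (j / u % t) (j % u)

/-- The upper end of the edge `j` in a sequence of theta graphs with `t` paths of `u` edges. -/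
def thetaTgt (t u j : ℕ) : ℕ × ℕ × ℕ := thetaVertex u (j / u / t) (j / u % t) (j % u + 1)

lemma thetaVertex_of_internal {c q i : ℕ} (h0 : i ≠ 0) (hu : i ≠ u) :
    thetaVertex u c q i = (c, q, i) := by simp [thetaVertex, h0, hu]

lemma thetaVertex_height (u c q i : ℕ) : (thetaVertex u c q i).2.2 = i := by
  unfold thetaVertex; split_ifs <;> rfl

lemma thetaVertex_fst (u c q i : ℕ) : (thetaVertex u c q i).1 = c := by
  unfold thetaVertex; split_ifs <;> rfl

lemma thetaSrc_ne_thetaTgt (j : ℕ) : thetaSrc t u j ≠ thetaTgt t u j := fun h ↦ by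
  have := congrArg (fun v ↦ v.2.2) h
  simp only [thetaSrc, thetaTgt, thetaVertex_height] at this
  omega

/-- The edge of given coordinates. -/
def thetaEdge (t u c q z : ℕ) : ℕ := (c * t + q) * u + z

lemma eq_thetaEdge (j : ℕ) : j = thetaEdge t u (j / u / t) (j / u % t) (j % u) := by
  rw [thetaEdge, mul_comm (j / u / t), Nat.div_add_mod, mul_comm, Nat.div_add_mod]

/-- The edges at an internal vertex. -/
lemma eq_thetaEdge_of_internal {c q i j : ℕ} (h0 : i ≠ 0) (hi : i < u)
    (h : thetaSrc t u j = (c, q, i) ∨ thetaTgt t u j = (c, q, i)) :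
    j = thetaEdge t u c q i ∨ j = thetaEdge t u c q (i - 1) := by
  rcases h with h | h
  · left
    have h1 : j % u = i := by
      simpa only [thetaSrc, thetaVertex_height] using congrArg (fun v ↦ v.2.2) h
    rw [thetaSrc, h1, thetaVertex_of_internal h0 hi.ne, Prod.mk.injEq, Prod.mk.injEq] at h
    rw [eq_thetaEdge (t := t) (u := u) j, h.1, h.2.1, h1]
  · right
    have h1 : j % u + 1 = i := by
      simpa only [thetaTgt, thetaVertex_height] using congrArg (fun v ↦ v.2.2) h
    rw [thetaTgt, h1, thetaVertex_of_internal h0 hi.ne, Prod.mk.injEq, Prod.mk.injEq] at h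
    rw [eq_thetaEdge (t := t) (u := u) j, h.1, h.2.1, ← h1, Nat.add_sub_cancel]

lemma div_thetaEdge {c q z : ℕ} (hz : z < u) : thetaEdge t u c q z / u = c * t + q := by
  rw [thetaEdge, mul_comm, Nat.mul_add_div (by omega), Nat.div_eq_of_lt hz, add_zero]

lemma mod_thetaEdge {c q z : ℕ} (hz : z < u) : thetaEdge t u c q z % u = z := by
  rw [thetaEdge, mul_comm, Nat.mul_add_mod, Nat.mod_eq_of_lt hz]

lemma thetaSrc_thetaEdge {c q z : ℕ} (hq : q < t) (hz : z < u) :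
    thetaSrc t u (thetaEdge t u c q z) = thetaVertex u c q z := by
  rw [thetaSrc, div_thetaEdge hz, mod_thetaEdge hz, mul_comm c, Nat.mul_add_div (by omega),
    Nat.div_eq_of_lt hq, Nat.mul_add_mod, Nat.mod_eq_of_lt hq, add_zero]

lemma thetaTgt_thetaEdge {c q z : ℕ} (hq : q < t) (hz : z < u) :
    thetaTgt t u (thetaEdge t u c q z) = thetaVertex u c q (z + 1) := by
  rw [thetaTgt, div_thetaEdge hz, mod_thetaEdge hz, mul_comm c, Nat.mul_add_div (by omega),
    Nat.div_eq_of_lt hq, Nat.mul_add_mod, Nat.mod_eq_of_lt hq, add_zero]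

/-- The degree of a vertex is at most the number of paths. -/
lemma exists_edges_at (ht : 2 ≤ t) (hu : 2 ≤ u) (v : ℕ × ℕ × ℕ) :
    ∃ T : Finset ℕ, T.card ≤ t ∧ ∀ j, thetaSrc t u j = v ∨ thetaTgt t u j = v → j ∈ T := by
  obtain ⟨c, q, i⟩ := v
  have hmod : ∀ j, j % u < u := fun j ↦ Nat.mod_lt _ (by omega)
  have hmodt : ∀ j, j / u % t < t := fun j ↦ Nat.mod_lt _ (by omega)
  have hcoord : ∀ j, thetaSrc t u j = (c, q, i) ∨ thetaTgt t u j = (c, q, i) →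
      j / u / t = c ∧ (j % u = i ∨ j % u + 1 = i) := by
    rintro j (h | h)
    · exact ⟨by simpa only [thetaSrc, thetaVertex_fst] using congrArg (fun v ↦ v.1) h, Or.inl <| by
        simpa only [thetaSrc, thetaVertex_height] using congrArg (fun v ↦ v.2.2) h⟩
    · exact ⟨by simpa only [thetaTgt, thetaVertex_fst] using congrArg (fun v ↦ v.1) h, Or.inr <| by
        simpa only [thetaTgt, thetaVertex_height] using congrArg (fun v ↦ v.2.2) h⟩
  by_cases hi : i ≠ 0 ∧ i < u
  · refine ⟨{thetaEdge t u c q i, thetaEdge t u c q (i - 1)}, Finset.card_le_two.trans ht,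
      fun j hj ↦ ?_⟩
    simpa using eq_thetaEdge_of_internal hi.1 hi.2 hj
  · refine ⟨(Finset.range t).image fun q' ↦ thetaEdge t u c q' (if i = 0 then 0 else u - 1),
      Finset.card_image_le.trans (by simp), fun j hj ↦ ?_⟩
    obtain ⟨h1, h2⟩ := hcoord j hj
    refine Finset.mem_image.2 ⟨j / u % t, Finset.mem_range.2 (hmodt j), ?_⟩
    have := hmod j
    have h3 : j % u = if i = 0 then 0 else u - 1 := by
      split_ifs <;> omega
    rw [← h3, ← h1, ← eq_thetaEdge]

/-- Used to spread membership from one internal vertex of a path in both directions up to its ends.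
-/
lemma forall_le_of_internal_step {P : ℕ → Prop}
    (h : ∀ i, 0 < i → i < u → P i → P (i - 1) ∧ P (i + 1)) {i₀ : ℕ} (h0 : 0 < i₀) (hi₀ : i₀ < u)
    (hP : P i₀) : ∀ i ≤ u, P i := by
  have hdown : ∀ m, P (i₀ - m) := by
    intro m
    induction m with
    | zero => exact hP
    | succ m ih =>
      rcases Nat.eq_zero_or_pos (i₀ - m) with hm | hm
      · rwa [show i₀ - (m + 1) = i₀ - m by omega]
      · rw [← Nat.sub_sub]
        exact (h _ hm (by omega) ih).1
  have hup : ∀ m, i₀ + m ≤ u → P (i₀ + m) := by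
    intro m
    induction m with
    | zero => exact fun _ ↦ hP
    | succ m ih => exact fun hm ↦ (h _ (by omega) (by omega) (ih (by omega))).2
  intro i hi
  rcases le_total i i₀ with hle | hle
  · rw [← Nat.sub_sub_self hle]
    exact hdown _
  · rw [← Nat.add_sub_of_le hle]
    exact hup _ (by omega)

/-- A set of vertices in which all degrees are at least two contains a cycle. -/
lemma le_card_of_forall_exists_edge (ht : 0 < t) (hu : 2 ≤ u) {I : Finset (ℕ × ℕ × ℕ)}
    (hne : I.Nonempty)
    (h : ∀ v ∈ I, ∀ j₀, ∃ j ≠ j₀, thetaSrc t u j ∈ I ∧ thetaTgt t u j ∈ I ∧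
      (thetaSrc t u j = v ∨ thetaTgt t u j = v)) : 2 * u ≤ I.card := by
  have hmod : ∀ j, j % u < u := fun j ↦ Nat.mod_lt _ (by omega)
  have hmodt : ∀ j, j / u % t < t := fun j ↦ Nat.mod_lt _ ht
  -- An internal vertex has only two edges. Excluding either one as `j₀` forces the other, so the
  -- whole path lies in `I`.
  have hpath : ∀ c q i, q < t → 0 < i → i < u → thetaVertex u c q i ∈ I →
      ∀ i' ≤ u, thetaVertex u c q i' ∈ I := by
    intro c q i hq h0 hi hI
    refine forall_le_of_internal_step (P := fun i ↦ thetaVertex u c q i ∈ I)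
      (fun i h0 hi hI ↦ ⟨?_, ?_⟩) h0 hi hI
    · obtain ⟨j, hj, h1, h2, h3⟩ := h _ hI (thetaEdge t u c q i)
      rw [thetaVertex_of_internal h0.ne' hi.ne] at h3
      rcases eq_thetaEdge_of_internal h0.ne' hi h3 with rfl | rfl
      · exact absurd rfl hj
      · rwa [thetaSrc_thetaEdge hq (by omega)] at h1
    · obtain ⟨j, hj, h1, h2, h3⟩ := h _ hI (thetaEdge t u c q (i - 1))
      rw [thetaVertex_of_internal h0.ne' hi.ne] at h3
      rcases eq_thetaEdge_of_internal h0.ne' hi h3 with rfl | rfl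
      · rwa [thetaTgt_thetaEdge hq hi] at h2
      · exact absurd rfl hj
  obtain ⟨c, q, hq, hall⟩ : ∃ c q, q < t ∧ ∀ i ≤ u, thetaVertex u c q i ∈ I := by
    obtain ⟨v, hv⟩ := hne
    obtain ⟨j, -, h1, h2, -⟩ := h v hv 0
    refine ⟨j / u / t, j / u % t, hmodt j, ?_⟩
    by_cases hj : j % u = 0
    · exact hpath _ _ (j % u + 1) (hmodt j) (by omega) (by omega) h2
    · exact hpath _ _ (j % u) (hmodt j) (by omega) (hmod j) h1
  -- A second edge at the common lower end starts another path, and the two paths close a cycle of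
  -- `2 * u` vertices.
  obtain ⟨q', hq', hqq', hall'⟩ : ∃ q', q' < t ∧ q' ≠ q ∧ ∀ i ≤ u, thetaVertex u c q' i ∈ I := by
    obtain ⟨j, hj, h1, h2, h3⟩ := h _ (hall 0 (Nat.zero_le u)) (thetaEdge t u c q 0)
    have hj0 : j % u = 0 ∧ j / u / t = c := by
      rcases h3 with h3 | h3
      · exact ⟨by simpa only [thetaSrc, thetaVertex_height] using congrArg (fun v ↦ v.2.2) h3,
          by simpa only [thetaSrc, thetaVertex_fst] using congrArg (fun v ↦ v.1) h3⟩
      · have := congrArg (fun v ↦ v.2.2) h3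
        simp only [thetaTgt, thetaVertex_height] at this
        omega
    refine ⟨j / u % t, hmodt j, fun hq ↦ hj ?_, ?_⟩
    · rw [eq_thetaEdge (t := t) (u := u) j, hj0.1, hj0.2, hq]
    · refine hpath _ _ 1 (hmodt j) one_pos hu ?_
      rwa [thetaTgt, hj0.1, hj0.2] at h2
  let A := (Finset.range (u + 1)).image fun i ↦ thetaVertex u c q i
  let B := (Finset.Ico 1 u).image fun i ↦ thetaVertex u c q' i
  have hinj : ∀ c q, Function.Injective fun i ↦ thetaVertex u c q i := fun c q i i' hii ↦ by
    simpa only [thetaVertex_height] using congrArg (fun v ↦ v.2.2) hii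
  have hAB : Disjoint A B := by
    rw [Finset.disjoint_left]
    intro v hA hB
    obtain ⟨i, -, rfl⟩ := Finset.mem_image.1 hA
    obtain ⟨i', hi', hii⟩ := Finset.mem_image.1 hB
    rw [Finset.mem_Ico] at hi'
    have h1 : i' = i := by
      simpa only [thetaVertex_height] using congrArg (fun v ↦ v.2.2) hii
    subst h1
    rw [thetaVertex_of_internal (by omega) (by omega),
      thetaVertex_of_internal (by omega) (by omega), Prod.mk.injEq, Prod.mk.injEq] at hii
    exact hqq' hii.2.1
  have hcard : (A ∪ B).card = 2 * u := by
    rw [Finset.card_union_of_disjoint hAB, Finset.card_image_of_injective _ (hinj c q),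
      Finset.card_image_of_injective _ (hinj c q'), Finset.card_range, Nat.card_Ico]
    omega
  rw [← hcard]
  refine Finset.card_le_card (Finset.union_subset ?_ ?_)
  · exact Finset.image_subset_iff.2 fun i hi ↦ hall i (by rw [Finset.mem_range] at hi; omega)
  · exact Finset.image_subset_iff.2 fun i hi ↦ hall' i (by rw [Finset.mem_Ico] at hi; omega)

/-- Small sets of vertices span forests. -/
lemma exists_edges_in (ht : 0 < t) (hu : 2 ≤ u) {I : Finset (ℕ × ℕ × ℕ)} (hne : I.Nonempty)
    (hI : I.card < 2 * u) :
    ∃ T : Finset ℕ, T.card + 1 ≤ I.card ∧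
      ∀ j, thetaSrc t u j ∈ I → thetaTgt t u j ∈ I → j ∈ T := by
  induction I using Finset.strongInduction with
  | H I ih =>
    -- Too small to contain a cycle, `I` has a vertex with at most one edge inside; it is pruned
    -- like a leaf.
    obtain ⟨v, hv, j₀, hj₀⟩ : ∃ v ∈ I, ∃ j₀, ∀ j, j ≠ j₀ → thetaSrc t u j ∈ I →
        thetaTgt t u j ∈ I → ¬ (thetaSrc t u j = v ∨ thetaTgt t u j = v) := by
      by_contra! hcon
      refine absurd (le_card_of_forall_exists_edge ht hu hne fun v hv j₀ ↦ ?_) (not_le.2 hI)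
      obtain ⟨j, h1, h2, h3, h4⟩ := hcon v hv j₀
      exact ⟨j, h1, h2, h3, h4⟩
    have hcard := Finset.card_erase_add_one hv
    rcases (I.erase v).eq_empty_or_nonempty with hemp | hne'
    · have hv' : ∀ w ∈ I, w = v := fun w hw ↦ by
        by_contra hwv
        have := Finset.mem_erase.2 ⟨hwv, hw⟩
        rw [hemp] at this
        exact Finset.notMem_empty _ this
      refine ⟨∅, by simpa using hne, fun j h1 h2 ↦ ?_⟩
      exact absurd ((hv' _ h1).trans (hv' _ h2).symm) (thetaSrc_ne_thetaTgt j)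
    · obtain ⟨T, hT, hT'⟩ := ih (I.erase v) (Finset.erase_ssubset hv) hne' (by omega)
      refine ⟨insert j₀ T, ?_, fun j h1 h2 ↦ ?_⟩
      · have := Finset.card_insert_le j₀ T
        omega
      · by_cases hj : j = j₀
        · exact hj ▸ Finset.mem_insert_self _ _
        · have h3 := hj₀ j hj h1 h2
          rw [not_or] at h3
          exact Finset.mem_insert_of_mem (hT' j (Finset.mem_erase.2 ⟨h3.1, h1⟩)
            (Finset.mem_erase.2 ⟨h3.2, h2⟩))

/-- The vertices of the paths `q < m` of the theta graph `c`. -/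
def thetaVertices (u c m : ℕ) : Finset (ℕ × ℕ × ℕ) :=
  {(c, 0, 0), (c, 0, u)} ∪ (Finset.range m ×ˢ Finset.Ico 1 u).image fun x ↦ (c, x.1, x.2)

lemma card_thetaVertices_le (u c m : ℕ) : (thetaVertices u c m).card ≤ m * (u - 1) + 2 := by
  refine (Finset.card_union_le _ _).trans ?_
  have h1 := Finset.card_image_le (s := Finset.range m ×ˢ Finset.Ico 1 u)
    (f := fun x ↦ (c, x.1, x.2))
  rw [Finset.card_product, Finset.card_range, Nat.card_Ico] at h1
  have h2 : ({(c, 0, 0), (c, 0, u)} : Finset (ℕ × ℕ × ℕ)).card ≤ 2 := Finset.card_le_two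
  omega

lemma thetaVertex_mem {c q i m : ℕ} (hq : q < m) (hi : i ≤ u) :
    thetaVertex u c q i ∈ thetaVertices u c m := by
  unfold thetaVertex thetaVertices
  split_ifs with h
  · rcases h with rfl | rfl <;> simp
  · refine Finset.mem_union_right _ (Finset.mem_image.2 ⟨(q, i), ?_, rfl⟩)
    rw [Finset.mem_product, Finset.mem_range, Finset.mem_Ico]
    omega

/-- The vertices of the first `x` edges of the theta graph `c`. -/
def thetaInitial (u c x : ℕ) : Finset (ℕ × ℕ × ℕ) :=
  if x < u then (Finset.range (x + 1)).image fun i ↦ (c, 0, i)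
  else thetaVertices u c (x / u) ∪ (Finset.Ico 1 (x % u + 1)).image fun i ↦ (c, x / u, i)

/-- A path of `x` edges has `x + 1` vertices; every completed path after the first saves one, as its
upper end is already present. This is the origin of `y` in the theorem. -/
lemma card_thetaInitial_add_le (hu : 2 ≤ u) (c x : ℕ) :
    (thetaInitial u c x).card + x / u ≤ x + 1 + min (x / u) 1 := by
  unfold thetaInitial
  split_ifs with h
  · have h1 := Finset.card_image_le (s := Finset.range (x + 1)) (f := fun i ↦ (c, 0, i))
    rw [Finset.card_range] at h1
    rw [Nat.div_eq_of_lt h]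
    omega
  · have h1 := Finset.card_image_le (s := Finset.Ico 1 (x % u + 1)) (f := fun i ↦ (c, x / u, i))
    rw [Nat.card_Ico] at h1
    have h2 := card_thetaVertices_le u c (x / u)
    have h3 := Finset.card_union_le (thetaVertices u c (x / u))
      ((Finset.Ico 1 (x % u + 1)).image fun i ↦ (c, x / u, i))
    have h4 := Nat.div_add_mod x u
    have h5 : 0 < x / u := Nat.div_pos (by omega) (by omega)
    have h6 : x / u * (u - 1) + x / u = u * (x / u) := by
      rw [← mul_add_one, mul_comm]; congr 1; omega
    omega

lemma thetaVertex_mem_initial (hu : 2 ≤ u) {c x j i : ℕ} (hj : j < x) (hi : i ≤ j % u + 1) :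
    thetaVertex u c (j / u) i ∈ thetaInitial u c x := by
  have hmod : j % u < u := Nat.mod_lt _ (by omega)
  have hdiv := Nat.div_add_mod j u
  have hdivx := Nat.div_add_mod x u
  unfold thetaInitial
  split_ifs with h
  · have h0 : j / u = 0 := Nat.div_eq_of_lt (by omega)
    rw [h0, mul_zero, zero_add] at hdiv
    refine Finset.mem_image.2 ⟨i, Finset.mem_range.2 (by omega), ?_⟩
    rw [h0]
    unfold thetaVertex
    split_ifs <;> rfl
  · rcases (Nat.div_le_div_right hj.le : j / u ≤ x / u).lt_or_eq with hlt | heq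
    · exact Finset.mem_union_left _ (thetaVertex_mem hlt (by omega))
    · rw [heq] at hdiv ⊢
      have h1 : x % u < u := Nat.mod_lt _ (by omega)
      by_cases hi0 : i = 0
      · refine Finset.mem_union_left _ ?_
        subst hi0
        have : 0 < x / u := Nat.div_pos (by omega) (by omega)
        have h2 := thetaVertex_mem (c := c) (q := 0) this (Nat.zero_le u)
        simpa [thetaVertex] using h2
      · refine Finset.mem_union_right _ ?_
        rw [thetaVertex_of_internal hi0 (by omega)]
        exact Finset.mem_image.2 ⟨i, Finset.mem_Ico.2 (by omega), rfl⟩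

/-- A sequence of theta graphs whose edges have multiplicity `s` gives a design. -/
theorem exists_mem_distances_of_theta {n k r δ κ ν a b s : ℕ} (hδ : 2 ≤ δ) (hrk : r < k)
    (ha : k + a = κ * r) (har : a < r) (hb : n + b = ν * (r + δ - 1)) (hκν : κ ≤ ν) (hs : 0 < s)
    (hu : 2 ≤ u) (ht : 2 ≤ t) (hκ : 0 < κ) (hκu : κ < 2 * u) (hsκ : s * (κ - 1) ≤ a)
    (htr : t * s ≤ r)
    (h0 : b % (s * t * u) = 0 → b / (s * t * u) * (t * (u - 1) + 2) ≤ ν)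
    (h1 : b % (s * t * u) ≠ 0 → ∀ x, b % (s * t * u) ≤ x * s → x * s < b % (s * t * u) + s →
      b / (s * t * u) * (t * (u - 1) + 2) + (x + 1 + min (x / u) 1) ≤ ν + x / u) :
    ∃ d : ℕ, (n : ℤ) - k + 1 - (κ - 1) * (δ - 1) ≤ d ∧ d ∈ distances n k r δ := by
  set Q := b / (s * t * u) with hQ
  set β := b % (s * t * u) with hβ
  have hmodt : ∀ j, j / u % t < t := fun j ↦ Nat.mod_lt _ (by omega)
  have hmod : ∀ j, j % u < u := fun j ↦ Nat.mod_lt _ (by omega)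
  have hbQ : s * t * u * Q + β = b := Nat.div_add_mod _ _
  let W₀ := (Finset.range Q).biUnion fun c ↦ thetaVertices u c t
  have hW₀ : W₀.card ≤ Q * (t * (u - 1) + 2) := by
    refine (Finset.card_biUnion_le_card_mul _ _ _ fun c _ ↦ card_thetaVertices_le u c t).trans ?_
    rw [Finset.card_range]
  -- After `Q` full theta graphs, the remaining `β` edges need `x = ⌈β / s⌉` simple edges of one
  -- more.
  obtain ⟨x, hx, hx'⟩ : ∃ x, β ≤ x * s ∧ x * s < β + s := by
    refine ⟨(β + s - 1) / s, ?_, ?_⟩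
    · have h2 := Nat.div_add_mod (β + s - 1) s
      have h3 := Nat.mod_lt (β + s - 1) hs
      rw [mul_comm] at h2
      omega
    · have := Nat.div_mul_le_self (β + s - 1) s
      omega
  let W := W₀ ∪ if β = 0 then ∅ else thetaInitial u Q x
  have hW : W.card ≤ ν := by
    refine (Finset.card_union_le _ _).trans ?_
    split_ifs with hβ0
    · have := h0 hβ0
      rw [Finset.card_empty]
      omega
    · have h2 := h1 hβ0 x hx hx'
      have h3 := card_thetaInitial_add_le hu Q x
      omega
  have hmem : ∀ j, j * s < b → ∀ i ≤ j % u + 1, thetaVertex u (j / u / t) (j / u % t) i ∈ W := by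
    intro j hj i hi
    have h2 := hmod j
    have h3 := Nat.div_add_mod (j / u) t
    have h4 := Nat.div_add_mod j u
    rcases lt_or_ge (j / u / t) Q with hlt | hge
    · exact Finset.mem_union_left _ (Finset.mem_biUnion.2 ⟨_, Finset.mem_range.2 hlt,
        thetaVertex_mem (hmodt j) (by omega)⟩)
    obtain ⟨y, rfl⟩ : ∃ y, j = y + t * u * Q := by
      refine ⟨j - t * u * Q, ?_⟩
      have h5 := Nat.mul_le_mul_left (u * t) hge
      have h6 : u * t * (j / u / t) ≤ j := by
        rw [Nat.div_div_eq_div_mul]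
        exact Nat.mul_div_le j _
      rw [mul_comm u t] at h5 h6
      omega
    have hy : y * s < β := by
      have : (y + t * u * Q) * s = y * s + s * t * u * Q := by ring
      omega
    have hyx : y < x := Nat.lt_of_mul_lt_mul_right (hy.trans_le hx)
    have hyt : y / u < t := by
      rw [Nat.div_lt_iff_lt_mul (by omega)]
      have h5 : β < s * t * u := Nat.mod_lt _ (by positivity)
      have h6 : y * s < t * u * s := by
        calc y * s < s * t * u := hy.trans h5
          _ = t * u * s := by ring
      exact Nat.lt_of_mul_lt_mul_right h6
    have e1 : (y + t * u * Q) / u = y / u + t * Q := by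
      rw [show y + t * u * Q = y + u * (t * Q) by ring, Nat.add_mul_div_left _ _ (by omega)]
    have e2 : (y + t * u * Q) % u = y % u := by
      rw [show y + t * u * Q = y + u * (t * Q) by ring, Nat.add_mul_mod_self_left]
    rw [e2] at hi
    rw [e1, Nat.add_mul_div_left _ _ (by omega), Nat.add_mul_mod_self_left,
      Nat.div_eq_of_lt hyt, Nat.mod_eq_of_lt hyt, zero_add]
    refine Finset.mem_union_right _ ?_
    rw [if_neg (by omega)]
    exact thetaVertex_mem_initial hu hyx hi
  refine exists_mem_distances_of_graph hδ hrk ha har hb hκν hs (f := thetaSrc t u)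
    (g := thetaTgt t u) thetaSrc_ne_thetaTgt hW (fun j hj ↦ hmem j hj _ (Nat.le_succ _))
    (fun j hj ↦ hmem j hj _ le_rfl) (fun v ↦ ?_) fun I hI ↦ ?_
  · obtain ⟨T, hT, hT'⟩ := exists_edges_at ht hu v
    exact ⟨T, (Nat.mul_le_mul_right s hT).trans htr, hT'⟩
  · obtain ⟨T, hT, hT'⟩ := exists_edges_in (t := t) (by omega) hu
      (Finset.card_pos.1 (hI ▸ hκ)) (hI ▸ hκu)
    refine ⟨T, (Nat.mul_le_mul_right s (by omega : T.card ≤ κ - 1)).trans ?_, hT'⟩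
    rwa [mul_comm]

end Theta

/-! ### Necessity in (iii), and the numerical conditions. -/

variable {n k r δ κ ν a b : ℕ}

lemma le_singletonBound_of_mem_distances {d : ℕ} (ha : k + a = κ * r) (har : a < r)
    (hd : d ∈ distances n k r δ) : (d : ℤ) ≤ n - k + 1 - (κ - 1) * (δ - 1) := by
  obtain ⟨α, M, hM⟩ := hd
  exact hM.le_singletonBound ha har

lemma bddAbove_distances (ha : k + a = κ * r) (har : a < r) : BddAbove (distances n k r δ) :=
  ⟨((n : ℤ) - k + 1 - (κ - 1) * (δ - 1)).toNat, fun d hd ↦ by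
    have := le_singletonBound_of_mem_distances ha har hd
    omega⟩

lemma isGreatest_dMax (ha : k + a = κ * r) (har : a < r) (h : (distances n k r δ).Nonempty) :
    IsGreatest (distances n k r δ) (dMax n k r δ) :=
  ⟨Nat.sSup_mem h (bddAbove_distances ha har),
    fun _ hd ↦ le_csSup (bddAbove_distances ha har) hd⟩

/-- The necessity of the numerical condition for `a < κ - 1`. -/
theorem forest_condition_of_mem_distances {d t : ℕ} (ha : k + a = κ * r) (har : a < r)
    (hb : n + b = ν * (r + δ - 1)) (hbN : b < r + δ - 1) (hκν : κ < ν)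
    (ht : (κ : ℤ) - 1 < (t + 2) * (κ - 1 - a))
    (hd : d ∈ distances n k r δ) (hdD : (d : ℤ) = n - k + 1 - (κ - 1) * (δ - 1)) :
    ((b : ℤ) - a) * (t + 1) ≤ t * (ν - κ + 1) := by
  classical
  obtain ⟨α, M, hM⟩ := hd
  obtain ⟨C, hC, hCn, hCκ⟩ := hM.exists_cover ha har hdD
  have hν : ν ≤ C.card := by
    have h1 := Finset.card_biUnion_le_card_mul C id (r + δ - 1) hC
    rw [hCn] at h1
    by_contra! hlt
    have h2 := Nat.mul_le_mul_right (r + δ - 1) (Nat.succ_le_of_lt hlt)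
    rw [Nat.succ_mul] at h2
    omega
  have h1 := deficiency_le (S := id) (N := r + δ - 1) (a := a) hC (fun I hI hIκ ↦ by
    have := hCκ I hI hIκ
    unfold deficiency
    rw [hIκ]
    zify at this
    linarith) ht (by omega)
  unfold deficiency at h1
  rw [hCn] at h1
  -- The cover may have `m` sets more than `ν`. They add `m * N` to the deficiency but only `t * m`
  -- to the right-hand side, so the inequality for `ν` follows.
  obtain ⟨m, hm⟩ := Nat.exists_eq_add_of_le hν
  rw [hm] at h1
  have hN : (1 : ℤ) ≤ (r + δ - 1 : ℕ) := by
    have := hM.two_le_delta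
    omega
  zify at hb
  push_cast at h1 hb
  generalize ((r + δ - 1 : ℕ) : ℤ) = N at *
  have h2 : (0 : ℤ) ≤ m * (N - 1) := mul_nonneg (by positivity) (by linarith)
  have h3 : (0 : ℤ) ≤ t * (m * (N - 1)) := by positivity
  have h4 : ((ν : ℤ) + m) * N - n - a = b - a + m * N := by linarith
  rw [h4] at h1
  nlinarith

lemma ceil_natCast_div_eq_iff {x y : ℕ} (hy : 0 < y) (z : ℤ) :
    z = ⌈(x : ℚ) / y⌉ ↔ (x : ℤ) ≤ z * y ∧ z * y < x + y := by
  have hy' : (0 : ℚ) < y := by exact_mod_cast hy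
  rw [eq_comm, Int.ceil_eq_iff, div_le_iff₀ hy', lt_div_iff₀ hy', sub_mul, one_mul, sub_lt_iff_lt_add]
  constructor
  · rintro ⟨h1, h2⟩
    exact ⟨by exact_mod_cast h2, by exact_mod_cast h1⟩
  · rintro ⟨h1, h2⟩
    exact ⟨by exact_mod_cast h2, by exact_mod_cast h1⟩

/-- The theta graph construction under the numerical condition on `ν`. -/
theorem exists_mem_distances_of_theta_condition (hδ : 2 ≤ δ) (hrk : r < k)
    (ha : k + a = κ * r) (har : a < r) (hb : n + b = ν * (r + δ - 1)) (hκν : κ ≤ ν)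
    (haκ : κ ≤ a + 1) (hκ3 : 3 ≤ κ) {s t u x y : ℤ} (hs : s = ⌊(a : ℚ) / ((κ : ℚ) - 1)⌋)
    (ht : t = ⌊((r : ℚ) - 1) / s⌋) (hu : u = ⌈((κ : ℚ) + 1) / 2⌉)
    (hx : x = ⌈((b : ℚ) - ⌊(b : ℚ) / ((s : ℚ) * t * u)⌋ * ((s : ℚ) * t * u)) / s⌉)
    (hy : s * t * u ∣ (b : ℤ) → y = 0)
    (hy' : ¬ s * t * u ∣ (b : ℤ) → y = x - ⌊(x : ℚ) / u⌋ + 1 + min ⌊(x : ℚ) / u⌋ 1)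
    (hν : ⌊(b : ℚ) / ((s : ℚ) * t * u)⌋ * (t * (u - 1) + 2) + y ≤ ν) :
    ∃ d : ℕ, (n : ℤ) - k + 1 - (κ - 1) * (δ - 1) ≤ d ∧ d ∈ distances n k r δ := by
  obtain ⟨K, rfl⟩ : ∃ K, κ = K + 1 := ⟨κ - 1, by omega⟩
  obtain ⟨R, rfl⟩ : ∃ R, r = R + 1 := ⟨r - 1, by omega⟩
  rw [Nat.cast_succ, add_sub_cancel_right, Rat.floor_natCast_div_natCast, ← Int.natCast_div]
    at hs
  have hsK := Nat.div_mul_le_self a K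
  have hspos : 0 < a / K := Nat.div_pos (by omega) (by omega)
  generalize a / K = s' at hs hsK hspos
  subst hs
  rw [Nat.cast_succ, add_sub_cancel_right, Int.cast_natCast, Rat.floor_natCast_div_natCast,
    ← Int.natCast_div] at ht
  have htR := Nat.div_mul_le_self R s'
  -- `s' * K ≤ a ≤ R` and `K = κ - 1 ≥ 2`.
  have ht2 : 2 ≤ R / s' := by
    rw [Nat.le_div_iff_mul_le hspos, mul_comm]
    have := Nat.mul_le_mul_left s' (show 2 ≤ K by omega)
    omega
  generalize R / s' = t' at ht htR ht2
  subst ht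
  rw [← Nat.cast_succ, show (2 : ℚ) = (2 : ℕ) by norm_num,
    ceil_natCast_div_eq_iff two_pos] at hu
  obtain ⟨u', rfl⟩ := Int.eq_ofNat_of_zero_le (a := u) (by push_cast at hu; omega)
  push_cast at hu
  have hprod : ((s' : ℤ) : ℚ) * ((t' : ℤ) : ℚ) * ((u' : ℤ) : ℚ) = ((s' * t' * u' : ℕ) : ℚ) := by
    push_cast
    ring
  have hQ : ⌊(b : ℚ) / ((s' * t' * u' : ℕ) : ℚ)⌋ = ((b / (s' * t' * u') : ℕ) : ℤ) := by
    rw [Rat.floor_natCast_div_natCast, Int.natCast_div]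
  rw [hprod, hQ] at hx hν
  have hβ : (b : ℚ) - ((b / (s' * t' * u') : ℕ) : ℤ) * ((s' * t' * u' : ℕ) : ℚ) =
      ((b % (s' * t' * u') : ℕ) : ℚ) := by
    rw [sub_eq_iff_eq_add', Int.cast_natCast, ← Nat.cast_mul, ← Nat.cast_add, mul_comm,
      Nat.div_add_mod]
  rw [hβ, Int.cast_natCast, ceil_natCast_div_eq_iff hspos] at hx
  have hdvd : ((s' : ℤ) * t' * u' ∣ (b : ℤ)) ↔ b % (s' * t' * u') = 0 := by
    rw [← Nat.dvd_iff_mod_eq_zero, ← Nat.cast_mul, ← Nat.cast_mul, Int.natCast_dvd_natCast]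
  rw [hdvd] at hy hy'
  have hu1 : ((u' - 1 : ℕ) : ℤ) = u' - 1 := by omega
  refine exists_mem_distances_of_theta (s := s') (t := t') (u := u') hδ hrk ha har hb hκν hspos
    (by omega) ht2 (by omega) (by omega) ?_ (by omega) (fun h0 ↦ ?_) fun h1 z hz hz' ↦ ?_
  · rwa [Nat.add_sub_cancel]
  · rw [hy h0, add_zero] at hν
    zify
    rw [hu1]
    exact_mod_cast hν
  · generalize b % (s' * t' * u') = β at *
    generalize b / (s' * t' * u') = Q at *
    have hxz : x = z := by
      zify at hz hz'
      have hs0 : (0 : ℤ) < s' := by exact_mod_cast hspos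
      refine le_antisymm ?_ ?_
      · have : x * s' < (z + 1) * s' := by linarith
        have := lt_of_mul_lt_mul_right this hs0.le
        omega
      · have : z * s' < (x + 1) * s' := by linarith
        have := lt_of_mul_lt_mul_right this hs0.le
        omega
    subst hxz
    have h2 := hy' h1
    rw [Int.cast_natCast, Int.cast_natCast, Rat.floor_natCast_div_natCast] at h2
    rw [h2] at hν
    zify
    rw [hu1]
    linarith

lemma forest_condition_iff {q t : ℕ} (hκ : κ = a + 1 + q) (ht : t = a / q) (hq : 0 < q) :
    (⌊(κ : ℚ) / 2⌋ ≤ (a : ℤ) ∧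
      (κ : ℚ) - 1 + ((b : ℚ) - a) * (1 + 1 / (t : ℚ)) ≤ (ν : ℚ)) ↔
    0 < t ∧ ((b : ℤ) - a) * (t + 1) ≤ t * (ν - κ + 1) := by
  have h1 : ⌊(κ : ℚ) / 2⌋ ≤ (a : ℤ) ↔ 0 < t := by
    rw [show (2 : ℚ) = (2 : ℕ) by norm_num, Rat.floor_natCast_div_natCast, ht,
      Nat.div_pos_iff]
    omega
  rw [h1]
  refine and_congr_right fun htpos ↦ ?_
  have ht' : (0 : ℚ) < t := by exact_mod_cast htpos
  have h2 : (κ : ℚ) - 1 + ((b : ℚ) - a) * (1 + 1 / (t : ℚ)) ≤ ν ↔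
      ((b : ℚ) - a) * (t + 1) ≤ t * (ν - κ + 1) := by
    have h3 : (1 + 1 / (t : ℚ)) = (t + 1) / t := by field_simp
    rw [h3, ← mul_div_assoc, ← le_sub_iff_add_le', div_le_iff₀ ht']
    constructor <;> intro h <;> linarith
  rw [h2]
  norm_cast

end LocalMatroid

theorem mainTheorem6 (n k r δ : ℕ) (κ ν a b : ℤ)
    (hδ : 2 ≤ δ)
    (hκ : κ = ⌈(k : ℚ) / r⌉)
    (hν : ν = ⌈(n : ℚ) / ((r : ℚ) + δ - 1)⌉)
    (hr : 0 < r) (hrk : r < k)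
    (hkn : (k : ℤ) ≤ n - κ * ((δ : ℤ) - 1))
    (ha : (k : ℤ) = κ * r - a)
    (hb : (n : ℤ) = ν * ((r : ℤ) + δ - 1) - b) :
    -- the maximum exists
    IsGreatest (LocalMatroid.distances n k r δ) (LocalMatroid.dMax n k r δ) ∧
    -- (i)
    (b ≤ a → (LocalMatroid.dMax n k r δ : ℤ) = LocalMatroid.singletonBound n k r δ) ∧
    -- (ii)
    (a < b → (r : ℤ) ≤ b →
      (n : ℤ) - k + 1 - κ * ((δ : ℤ) - 1) + (b - r) ≤ (LocalMatroid.dMax n k r δ : ℤ)) ∧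
    -- (iii)
    (a < b → a < κ - 1 → ∀ t : ℤ, t = ⌊(a : ℚ) / ((κ : ℚ) - 1 - a)⌋ →
      ((LocalMatroid.dMax n k r δ : ℤ) = LocalMatroid.singletonBound n k r δ ↔
        ⌊(κ : ℚ) / 2⌋ ≤ a ∧
          (κ : ℚ) - 1 + ((b : ℚ) - a) * (1 + 1 / (t : ℚ)) ≤ (ν : ℚ))) ∧
    -- (iv)
    (a < b → κ - 1 ≤ a → 3 ≤ κ → ∀ s t u x y : ℤ,
      s = ⌊(a : ℚ) / ((κ : ℚ) - 1)⌋ →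
      t = ⌊((r : ℚ) - 1) / s⌋ →
      u = ⌈((κ : ℚ) + 1) / 2⌉ →
      x = ⌈((b : ℚ) - ⌊(b : ℚ) / ((s : ℚ) * t * u)⌋ * ((s : ℚ) * t * u)) / s⌉ →
      (s * t * u ∣ b → y = 0) →
      (¬ s * t * u ∣ b → y = x - ⌊(x : ℚ) / u⌋ + 1 + min ⌊(x : ℚ) / u⌋ 1) →
      ⌊(b : ℚ) / ((s : ℚ) * t * u)⌋ * (t * (u - 1) + 2) + y ≤ ν →
      (LocalMatroid.dMax n k r δ : ℤ) = LocalMatroid.singletonBound n k r δ) ∧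
    -- (v), where the second condition is void if its denominator vanishes
    (a < b → κ - 1 ≤ a → κ = 2 →
      ((2 * a ≤ (r : ℤ) - 1 ∧ ⌈(b : ℚ) / a⌉ + 1 ≤ ν) ∨
        ((r : ℤ) - 1 < 2 * a ∧ 0 < ⌊((r : ℚ) - 1) / 2⌋ ∧
          ⌈(b : ℚ) / ⌊((r : ℚ) - 1) / 2⌋⌉ + 1 ≤ ν)) →
      (LocalMatroid.dMax n k r δ : ℤ) = LocalMatroid.singletonBound n k r δ) := by
  have hNcast : (r : ℚ) + δ - 1 = ((r + δ - 1 : ℕ) : ℚ) := by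
    rw [Nat.cast_sub (by omega)]
    push_cast
    ring
  have hNcast' : (r : ℤ) + δ - 1 = ((r + δ - 1 : ℕ) : ℤ) := by omega
  have hNpos : 0 < r + δ - 1 := by omega
  rw [hNcast, LocalMatroid.ceil_natCast_div_eq_iff hNpos] at hν
  have hbound : LocalMatroid.singletonBound n k r δ =
      (n : ℤ) - k + 1 - (κ - 1) * ((δ : ℤ) - 1) := by
    rw [LocalMatroid.singletonBound, ← hκ]
  rw [LocalMatroid.ceil_natCast_div_eq_iff hr] at hκ
  rw [hNcast'] at hb
  have hr' : (0 : ℤ) < r := by exact_mod_cast hr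
  have hN' : (0 : ℤ) < (r + δ - 1 : ℕ) := by exact_mod_cast hNpos
  have hκ2 : 2 ≤ κ := by
    have h1 : (1 : ℤ) * r < κ * r := by
      have : (r : ℤ) < k := by exact_mod_cast hrk
      linarith
    have := lt_of_mul_lt_mul_right h1 hr'.le
    omega
  have hκN : κ * ((r + δ - 1 : ℕ) : ℤ) = κ * r + κ * ((δ : ℤ) - 1) := by
    rw [← hNcast']
    ring
  have hκν : κ ≤ ν := by
    by_contra! h
    have h1 : (ν + 1) * ((r + δ - 1 : ℕ) : ℤ) ≤ κ * ((r + δ - 1 : ℕ) : ℤ) :=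
      mul_le_mul_of_nonneg_right (by omega) hN'.le
    rw [add_mul, one_mul] at h1
    omega
  -- The hypothesis `hkn` says `κ * N - a ≤ ν * N - b` with `N = r + δ - 1`.
  have hκν' : a < b → κ < ν := fun hab ↦ by
    by_contra! h
    have h1 : ν * ((r + δ - 1 : ℕ) : ℤ) ≤ κ * ((r + δ - 1 : ℕ) : ℤ) :=
      mul_le_mul_of_nonneg_right h hN'.le
    linarith
  lift κ to ℕ using by omega
  lift ν to ℕ using by omega
  lift a to ℕ using by omega
  lift b to ℕ using by omega
  have ha' : k + a = κ * r := by zify; linarith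
  have hb' : n + b = ν * (r + δ - 1) := by
    have : ((n + b : ℕ) : ℤ) = ((ν * (r + δ - 1) : ℕ) : ℤ) := by
      rw [Nat.cast_mul]
      push_cast
      linarith
    exact_mod_cast this
  have har : a < r := by omega
  have hbN : b < r + δ - 1 := by omega
  norm_cast at hκν hκ2
  have hκν'' : a < b → κ < ν := fun h ↦ by exact_mod_cast hκν' (by exact_mod_cast h)
  clear hκ hν hκν' hkn ha hb hκN hN' hr' hNcast
  simp only [Int.cast_natCast]
  have hne : (LocalMatroid.distances n k r δ).Nonempty := by
    rcases le_or_gt b a with hba | hab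
    · obtain ⟨d, -, hd⟩ := LocalMatroid.exists_mem_distances_of_le hδ hrk ha' har hb' hκν hba
      exact ⟨d, hd⟩
    · obtain ⟨d, -, hd⟩ := LocalMatroid.exists_mem_distances_of_lt hδ hr hrk ha' hb'
        (hκν'' hab) hbN
      exact ⟨d, hd⟩
  have hgreat := LocalMatroid.isGreatest_dMax ha' har hne
  have hle : ∀ d ∈ LocalMatroid.distances n k r δ, d ≤ LocalMatroid.dMax n k r δ :=
    fun d hd ↦ hgreat.2 hd
  have hattain : (∃ d : ℕ, (n : ℤ) - k + 1 - (κ - 1) * (δ - 1) ≤ d ∧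
      d ∈ LocalMatroid.distances n k r δ) →
      (LocalMatroid.dMax n k r δ : ℤ) = LocalMatroid.singletonBound n k r δ := by
    rintro ⟨d, hd, hmem⟩
    have h1 := hle d hmem
    have h2 := LocalMatroid.le_singletonBound_of_mem_distances ha' har hgreat.1
    rw [hbound]
    zify at h1
    linarith
  refine ⟨hgreat, fun hba ↦ ?_, fun hab hrb ↦ ?_, fun hab haκ t ht ↦ ?_,
    fun hab haκ hκ3 s t u x y hs ht hu hx hy hy' hν ↦ ?_, fun hab haκ hκ2 h ↦ ?_⟩
  · exact hattain (LocalMatroid.exists_mem_distances_of_le hδ hrk ha' har hb' hκν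
      (by exact_mod_cast hba))
  · obtain ⟨d, hd, hmem⟩ := LocalMatroid.exists_mem_distances_of_lt hδ hr hrk ha' hb'
      (hκν'' (by exact_mod_cast hab)) hbN
    have h1 := hle d hmem
    zify at h1
    linarith
  · norm_cast at hab
    obtain ⟨q, hq, hκq⟩ : ∃ q, 0 < q ∧ κ = a + 1 + q := ⟨κ - (a + 1), by omega, by omega⟩
    have hq' : (κ : ℚ) - 1 - a = (q : ℚ) := by
      rw [hκq]
      push_cast
      ring
    rw [hq', Rat.floor_natCast_div_natCast, ← Int.natCast_div] at ht
    subst ht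
    rw [Int.cast_natCast, LocalMatroid.forest_condition_iff hκq rfl hq]
    constructor
    · intro heq
      -- From `a < (a / q + 1) * q` and `κ - 1 = a + q`.
      have h1 : (κ : ℤ) - 1 < ((a / q : ℕ) + 2) * (κ - 1 - a) := by
        have h2 := Nat.lt_div_mul_add (a := a) hq
        rw [hκq]
        zify at h2 ⊢
        linarith
      have h2 := LocalMatroid.forest_condition_of_mem_distances ha' har hb' hbN (hκν'' hab) h1
        hgreat.1 (heq.trans hbound)
      -- For `a / q = 0` the inequality reads `b ≤ a`.
      refine ⟨Nat.pos_of_ne_zero fun h0 ↦ ?_, h2⟩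
      rw [h0] at h2
      push_cast at h2
      omega
    · rintro ⟨h1, h2⟩
      refine hattain (LocalMatroid.exists_mem_distances_of_forest hδ hrk ha' har hb' hκν
        (by omega) h1 ?_ h2)
      have h3 := Nat.div_mul_le_self a q
      rw [hκq]
      zify at h3 ⊢
      linarith
  · exact hattain (LocalMatroid.exists_mem_distances_of_theta_condition hδ hrk ha' har hb' hκν
      (by omega) (by omega) hs ht hu hx hy hy' hν)
  · obtain rfl : κ = 2 := by omega
    have hpath : ∀ s : ℕ, 0 < s → s ≤ a → 2 * s ≤ r → ⌈(b : ℚ) / s⌉ + 1 ≤ (ν : ℤ) →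
        ∃ d : ℕ, (n : ℤ) - k + 1 - (2 - 1) * (δ - 1) ≤ d ∧
          d ∈ LocalMatroid.distances n k r δ := by
      intro s hs hsa hsr hν
      refine LocalMatroid.exists_mem_distances_of_path hδ hrk ha' har hb' hκν hs hsa hsr ?_
      have h1 := ((LocalMatroid.ceil_natCast_div_eq_iff (x := b) hs _).1 rfl).1
      have h2 : (⌈(b : ℚ) / s⌉ : ℤ) * s ≤ (ν - 1 : ℤ) * s :=
        mul_le_mul_of_nonneg_right (by omega) (by positivity)
      zify [show 1 ≤ ν by omega]
      linarith
    refine hattain ?_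
    rcases h with ⟨h1, h2⟩ | ⟨h1, h2, h3⟩
    · exact hpath a (by omega) le_rfl (by omega) h2
    · have h4 : ⌊((r : ℚ) - 1) / 2⌋ = (((r - 1) / 2 : ℕ) : ℤ) := by
        rw [Int.natCast_div, ← Rat.floor_natCast_div_natCast, Nat.cast_sub (by omega)]
        norm_num
      rw [h4] at h2 h3
      norm_cast at h2
      rw [Int.cast_natCast] at h3
      exact hpath ((r - 1) / 2) h2 (by omega) (by omega) h3
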